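/- **Setting.** Let $(\cdot,\cdot)_+$ be the scalar product of $L_2(\mathbb{R}_+,\mathbb{C}^2)$ or $L_2(\mathbb{R}_+)$ (linear in the first argument). For $\mathbf f=(f_1,f_2)$ put $[\mathbf f]_r=\frac12(f_1(0+)+f_2(0+))$ and $[\mathbf f]_s=f_1(0+)-f_2(0+)$. For $a\in\mathbb{C}$ and $\mathbf q=(q_1,q_2)\in L_2(\mathbb{R}_+,\mathbb{C}^2)$ let $\mathbf H_{a\mathbf q}$ be the operator in $L_2(\mathbb{R}_+,\mathbb{C}^2)$ $$\mathbf H_{a\mathbf q}\mathbf f=-\mathbf f''+[\mathbf f]_r\,\mathbf q,\qquad \mathcal D(\mathbf H_{a\mathbf q})=\{\mathbf f\in W_2^2(\mathbb{R}_+,\mathbb{C}^2):\ [\mathbf f]_s=0,\ 2[\mathbf f']_r=a[\mathbf f]_r+(\mathbf f,\mathbf q)_+\},$$ and let $\mathbf H_\infty$ (on $\mathbb{C}^2$-valued functions) and $H_\infty$ (on scalar functions) be $-d^2/dx^2$ on the $W_2^2$-functions that vanish at $0$. For an inner function $\psi\in H^\infty(\mathbb{C}_+)$ let $\psi(\mathcal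 B)=F^{-1}\psi(\delta)F$ on $L_2(\mathbb{R}_+)\subset L_2(\mathbb{R})$, where $Ff(\delta)=\frac1{\sqrt{2\pi}}\int e^{i\delta s}f(s)\,ds$; for $\psi=0$ put $\psi(\mathcal B)=0$. Assume that $\psi_1,\psi_2$ are such that each $\psi_j$ is inner or zero, not both are zero, and $\psi_j(\mathcal B)L_2(\mathbb{R}_+)\perp q_j$ for $j=1,2$. (Such a pair exists if and only if $\mathbf q$ is non-cyclic for the backward shift.) Let $\Psi_j$ be the holomorphic continuation of $\psi_j(-\delta)/\psi_j(\delta)$, $\delta\in\mathbb{R}$, into $\mathbb{C}_-=\{\operatorname{Im}z<0\}$ with $|\Psi_j|\le1$ ($\Psi_j=0$ if $\psi_j=0$). For $z,\mu\in\mathbb{C}_-$ let $$W(z^2)=-2iz-2\int_0^\infty e^{-izx}\,\operatorname{Re}(q_1+q_2)(x)\,dx+((\mathbf H_\infty-z^2I)^{-1}\mathbf q,\mathbf q)_+,$$ $$c(\mu,q_j)=\overline{\psi_j(\overline\mu)}+2(\operatorname{Im}\mu)\,\bigl((H_\infty-\mu^2I)^{-1}q_j,\ \psi_j(\mathcal B)e^{-i\mu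 x}\bigr)_+ .$$ The $S$-matrix of $\mathbf H_{a\mathbf q}$ is the meromorphic $2\times2$-matrix function on $\mathbb{C}_-$ $$S_{\mathbf H_{a\mathbf q}}(z)=\operatorname{diag}(\Psi_1(z),\Psi_2(z))-\frac{2zi}{a-W(z^2)}\Bigl[c(z,q_i)\,\overline{c(-\overline z,q_j)}\Bigr]_{i,j=1,2}.$$ **Lemma.** $\mathbf H_{a\mathbf q}$ is densely defined, its adjoint $\mathbf H^*_{a\mathbf q}$ is again an operator of the above form, so that its $S$-matrix (formed with the same $\psi_j$) makes sense, and on $\mathbb{C}_-$ $$S^*_{\mathbf H_{a\mathbf q}}(z)=S_{\mathbf H_{\overline a\mathbf q}}(-\overline z)=S_{\mathbf H^*_{a\mathbf q}}(-\overline z)$$ as an identity of meromorphic functions. Precisely: at each $z\in\mathbb{C}_-$ with $a\neq W(z^2)$ one has $\overline a\neq W((-\overline z)^2)$ and the identity holds at $z$; and if $S_{\mathbf H_{a\mathbf q}}(w)$ has a limit $M$ as $w\to z$, $w\ne z$, at some $z\in\mathbb{C}_-$, then $S_{\mathbf H_{\overline a\mathbf q}}$ and $S_{\mathbf H^*_{a\mathbf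 q}}$ both have the limit $M^*$ at $-\overline z$. -/

import Mathlib

open MeasureTheory Set Filter Topology
open scoped ComplexConjugate FourierTransform

noncomputable section

namespace NonlocalDelta

/-! ### The spaces `L₂(ℝ₊, E)` and Sobolev data on the half-line -/

/-- The Hilbert space `L₂(ℝ₊, E)`. -/
abbrev L2 (E : Type) [NormedAddCommGroup E] : Type :=
  Lp E 2 ((volume : Measure ℝ).restrict (Ioi 0))

/-- The Euclidean space `ℂ²`; the components `f₁, f₂` of a vector have the indices `0, 1`. -/
abbrev C2 : Type := EuclideanSpace ℂ (Fin 2)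

/-- The class of a square-integrable function in `L₂(μ, E)` (and `0` for any other function). -/
def toL2 {E : Type} [NormedAddCommGroup E] (μ : Measure ℝ) (g : ℝ → E) : Lp E 2 μ := by
  classical
  exact if h : MemLp g 2 μ then h.toLp g else 0

/-- The scalar product `(f, g)₊` of `L₂(ℝ₊, E)`, linear in the first argument. -/
def pairing {E : Type} [NormedAddCommGroup E] [InnerProductSpace ℂ E] (f g : L2 E) : ℂ :=
  inner ℂ g f

/-- `IsW1 f f' c`: the function `f ∈ L₂(ℝ₊, E)` has the absolutely continuous representative
`x ↦ c + ∫₀ˣ f'` with `f' ∈ L₂(ℝ₊, E)`. In other words `f ∈ W₂¹(ℝ₊, E)`, its derivative is `f'`,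
and `f(0+) = c`. -/
def IsW1 {E : Type} [NormedAddCommGroup E] [NormedSpace ℂ E] (f f' : L2 E) (c : E) : Prop :=
  ∀ᵐ x ∂((volume : Measure ℝ).restrict (Ioi 0)), f x = c + ∫ t in (0 : ℝ)..x, f' t

/-- `IsW2 f f' f'' c₀ c₁`: the function `f` belongs to `W₂²(ℝ₊, E)`, its first two derivatives are
`f'` and `f''`, and `f(0+) = c₀`, `f'(0+) = c₁`. -/
def IsW2 {E : Type} [NormedAddCommGroup E] [NormedSpace ℂ E]
    (f f' f'' : L2 E) (c₀ c₁ : E) : Prop :=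
  IsW1 f f' c₀ ∧ IsW1 f' f'' c₁

theorem L2.intervalIntegrable {E : Type} [NormedAddCommGroup E] (f : L2 E) {x : ℝ} (hx : 0 ≤ x) :
    IntervalIntegrable f volume 0 x := by
  rw [intervalIntegrable_iff_integrableOn_Ioc_of_le hx]
  have h1 : MemLp f 2 ((volume : Measure ℝ).restrict (Ioc 0 x)) :=
    (Lp.memLp f).mono_measure (Measure.restrict_mono (fun y hy => hy.1) le_rfl)
  have : IsFiniteMeasure ((volume : Measure ℝ).restrict (Ioc 0 x)) := ⟨by simp⟩
  exact h1.integrable (by norm_num)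

theorem IsW1.add {E : Type} [NormedAddCommGroup E] [NormedSpace ℂ E] {f f' g g' : L2 E} {c d : E}
    (hf : IsW1 f f' c) (hg : IsW1 g g' d) : IsW1 (f + g) (f' + g') (c + d) := by
  filter_upwards [hf, hg, Lp.coeFn_add f g, ae_restrict_mem measurableSet_Ioi]
    with x h1 h2 h3 hx
  have hx' : (0 : ℝ) ≤ x := le_of_lt hx
  have h4 : ∫ t in (0 : ℝ)..x, (f' + g' : L2 E) t = ∫ t in (0 : ℝ)..x, (f' t + g' t) := by
    apply intervalIntegral.integral_congr_ae
    have := (ae_restrict_iff' measurableSet_Ioi).1 (Lp.coeFn_add f' g')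
    filter_upwards [this] with t ht hmem
    rw [uIoc_of_le hx'] at hmem
    simpa using ht hmem.1
  rw [h3, Pi.add_apply, h1, h2, h4,
    intervalIntegral.integral_add (L2.intervalIntegrable f' hx') (L2.intervalIntegrable g' hx')]
  abel

theorem IsW1.smul {E : Type} [NormedAddCommGroup E] [NormedSpace ℂ E] {f f' : L2 E} {c : E}
    (r : ℂ) (hf : IsW1 f f' c) : IsW1 (r • f) (r • f') (r • c) := by
  filter_upwards [hf, Lp.coeFn_smul r f, ae_restrict_mem measurableSet_Ioi] with x h1 h3 hx
  have hx' : (0 : ℝ) ≤ x := le_of_lt hx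
  have h4 : ∫ t in (0 : ℝ)..x, (r • f' : L2 E) t = ∫ t in (0 : ℝ)..x, r • f' t := by
    apply intervalIntegral.integral_congr_ae
    have := (ae_restrict_iff' measurableSet_Ioi).1 (Lp.coeFn_smul r f')
    filter_upwards [this] with t ht hmem
    rw [uIoc_of_le hx'] at hmem
    simpa using ht hmem.1
  rw [h3, Pi.smul_apply, h1, h4, intervalIntegral.integral_smul, smul_add]

theorem isW1_zero {E : Type} [NormedAddCommGroup E] [NormedSpace ℂ E] :
    IsW1 (0 : L2 E) 0 0 := by
  have hz := Lp.coeFn_zero E 2 ((volume : Measure ℝ).restrict (Ioi 0))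
  filter_upwards [hz, ae_restrict_mem measurableSet_Ioi] with x h1 hx
  have h4 : ∫ t in (0 : ℝ)..x, (0 : L2 E) t = ∫ t in (0 : ℝ)..x, (0 : E) := by
    apply intervalIntegral.integral_congr_ae
    have := (ae_restrict_iff' measurableSet_Ioi).1 hz
    filter_upwards [this] with t ht hmem
    rw [uIoc_of_le (le_of_lt hx)] at hmem
    simpa using ht hmem.1
  rw [h1, h4]
  simp

/-- The derivative and the boundary value of a function of `W₂¹` are determined by the function. -/
theorem IsW1.eq_zero {E : Type} [NormedAddCommGroup E] [NormedSpace ℂ E] [CompleteSpace E]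
    {f f' : L2 E} {c : E} (h : IsW1 f f' c) (hf : f = 0) : f' = 0 ∧ c = 0 := by
  subst hf
  set g : ℝ → E := (Ioi (0 : ℝ)).indicator f' with hg
  have hg2 : MemLp g 2 volume := (memLp_indicator_iff_restrict measurableSet_Ioi).2 (Lp.memLp f')
  have hloc : LocallyIntegrable g volume := hg2.locallyIntegrable (by norm_num)
  have hint : ∀ a b, IntervalIntegrable g volume a b := fun a b =>
    (hloc.integrableOn_isCompact isCompact_uIcc).intervalIntegrable
  have hcont : Continuous fun x => ∫ t in (0 : ℝ)..x, g t :=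
    intervalIntegral.continuous_primitive hint 0
  have hae : (fun x => ∫ t in (0 : ℝ)..x, g t)
      =ᵐ[(volume : Measure ℝ).restrict (Ioi 0)] fun _ => -c := by
    filter_upwards [h, Lp.coeFn_zero E 2 ((volume : Measure ℝ).restrict (Ioi 0)),
      ae_restrict_mem measurableSet_Ioi] with x h1 h2 hx
    have h3 : ∫ t in (0 : ℝ)..x, g t = ∫ t in (0 : ℝ)..x, f' t := by
      apply intervalIntegral.integral_congr_ae
      refine Eventually.of_forall fun t hmem => ?_
      rw [uIoc_of_le (le_of_lt hx)] at hmem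
      exact indicator_of_mem (show t ∈ Ioi (0 : ℝ) from hmem.1) _
    rw [h2, Pi.zero_apply] at h1
    rw [h3]
    exact (neg_eq_of_add_eq_zero_right h1.symm).symm
  have heq : EqOn (fun x => ∫ t in (0 : ℝ)..x, g t) (fun _ => -c) (Ioi 0) :=
    Measure.eqOn_open_of_ae_eq hae isOpen_Ioi hcont.continuousOn continuousOn_const
  have hc : c = 0 := by
    have h0 := heq.closure hcont continuous_const
    rw [closure_Ioi] at h0
    have := h0 (self_mem_Ici (a := (0 : ℝ)))
    simpa using this
  refine ⟨?_, hc⟩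
  have hd := _root_.LocallyIntegrable.ae_hasDerivAt_integral hloc
  have : f' =ᵐ[(volume : Measure ℝ).restrict (Ioi 0)] (0 : L2 E) := by
    filter_upwards [ae_restrict_of_ae hd, Lp.coeFn_zero E 2 ((volume : Measure ℝ).restrict (Ioi 0)),
      ae_restrict_mem measurableSet_Ioi] with x h1 h2 hx
    have h3 : HasDerivAt (fun x => ∫ t in (0 : ℝ)..x, g t) (g x) x := h1 0
    have h4 : HasDerivAt (fun x => ∫ t in (0 : ℝ)..x, g t) 0 x :=
      (hasDerivAt_const x (-c)).congr_of_eventuallyEq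
        (heq.eventuallyEq_of_mem (isOpen_Ioi.mem_nhds hx))
    have h5 := h3.unique h4
    rw [h2, Pi.zero_apply, ← h5]
    exact (indicator_of_mem hx _).symm
  exact Lp.ext this

/-! ### The operators `H_{a q}` and `H_∞` -/

/-- `[c]_r = (c₁ + c₂) / 2`. -/
def meanVal (c : C2) : ℂ := (c 0 + c 1) / 2

/-- `[c]_s = c₁ - c₂`. -/
def jump (c : C2) : ℂ := c 0 - c 1

/-- The graph of `H_{a q}`: the pairs `(f, -f'' + [f]_r q)` with `f ∈ W₂²(ℝ₊, ℂ²)`, `[f]_s = 0`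
and `2 [f']_r = a [f]_r + (f, q)₊`. -/
def graphH (a : ℂ) (q : L2 C2) : Submodule ℂ (L2 C2 × L2 C2) where
  carrier := {p | ∃ (f' f'' : L2 C2) (c₀ c₁ : C2), IsW2 p.1 f' f'' c₀ c₁ ∧ jump c₀ = 0 ∧
    2 * meanVal c₁ = a * meanVal c₀ + pairing p.1 q ∧ p.2 = -f'' + meanVal c₀ • q}
  zero_mem' := by
    refine ⟨0, 0, 0, 0, ⟨isW1_zero, isW1_zero⟩, ?_, ?_, ?_⟩ <;> simp [jump, meanVal, pairing]
  add_mem' := by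
    rintro ⟨f, h⟩ ⟨g, k⟩ ⟨f', f'', c₀, c₁, hw, hj, hb, he⟩ ⟨g', g'', d₀, d₁, hw', hj', hb', he'⟩
    refine ⟨f' + g', f'' + g'', c₀ + d₀, c₁ + d₁, ⟨hw.1.add hw'.1, hw.2.add hw'.2⟩, ?_, ?_, ?_⟩
    · simp only [jump, PiLp.add_apply] at *
      linear_combination hj + hj'
    · simp only [meanVal, pairing, PiLp.add_apply, Prod.fst_add, inner_add_right] at *
      linear_combination hb + hb'
    · simp only [Prod.snd_add] at *
      have : meanVal (c₀ + d₀) = meanVal c₀ + meanVal d₀ := by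
        simp only [meanVal, PiLp.add_apply]
        ring
      rw [he, he', this]
      module
  smul_mem' := by
    rintro r ⟨f, h⟩ ⟨f', f'', c₀, c₁, hw, hj, hb, he⟩
    refine ⟨r • f', r • f'', r • c₀, r • c₁, ⟨hw.1.smul r, hw.2.smul r⟩, ?_, ?_, ?_⟩
    · simp only [jump, PiLp.smul_apply, smul_eq_mul] at *
      linear_combination r * hj
    · simp only [meanVal, pairing, PiLp.smul_apply, smul_eq_mul, Prod.smul_fst,
        inner_smul_right] at *
      linear_combination r * hb
    · simp only [Prod.smul_snd] at *
      have : meanVal (r • c₀) = r * meanVal c₀ := by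
        simp only [meanVal, PiLp.smul_apply, smul_eq_mul]
        ring
      rw [he, this]
      module

theorem graphH_functional (a : ℂ) (q : L2 C2) (p : L2 C2 × L2 C2) (hp : p ∈ graphH a q)
    (h0 : p.1 = 0) : p.2 = 0 := by
  obtain ⟨f', f'', c₀, c₁, hw, -, -, he⟩ := hp
  obtain ⟨h1, h2⟩ := hw.1.eq_zero h0
  obtain ⟨h3, -⟩ := hw.2.eq_zero h1
  rw [he, h3, h2]
  simp [meanVal]

/-- The operator `H_{a q} f = -f'' + [f]_r q` in `L₂(ℝ₊, ℂ²)`, with the domain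
`{f ∈ W₂²(ℝ₊, ℂ²) : [f]_s = 0, 2 [f']_r = a [f]_r + (f, q)₊}`. -/
def opH (a : ℂ) (q : L2 C2) : L2 C2 →ₗ.[ℂ] L2 C2 := (graphH a q).toLinearPMap

theorem opH_graph (a : ℂ) (q : L2 C2) : (opH a q).graph = graphH a q :=
  Submodule.toLinearPMap_graph_eq _ (graphH_functional a q)

/-- The graph of `H_∞ = -d²/dx²`, `D(H_∞) = {f ∈ W₂²(ℝ₊, E) : f(0) = 0}`. -/
def graphDirichlet (E : Type) [NormedAddCommGroup E] [NormedSpace ℂ E] :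
    Submodule ℂ (L2 E × L2 E) where
  carrier := {p | ∃ (f' f'' : L2 E) (c₁ : E), IsW2 p.1 f' f'' 0 c₁ ∧ p.2 = -f''}
  zero_mem' := ⟨0, 0, 0, ⟨isW1_zero, isW1_zero⟩, by simp⟩
  add_mem' := by
    rintro ⟨f, h⟩ ⟨g, k⟩ ⟨f', f'', c₁, hw, he⟩ ⟨g', g'', d₁, hw', he'⟩
    refine ⟨f' + g', f'' + g'', c₁ + d₁, ⟨?_, hw.2.add hw'.2⟩, ?_⟩
    · simpa using hw.1.add hw'.1
    · simp only [Prod.snd_add] at *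
      rw [he, he']
      abel
  smul_mem' := by
    rintro r ⟨f, h⟩ ⟨f', f'', c₁, hw, he⟩
    refine ⟨r • f', r • f'', r • c₁, ⟨?_, hw.2.smul r⟩, ?_⟩
    · simpa using hw.1.smul r
    · simp only [Prod.smul_snd] at *
      rw [he, smul_neg]

theorem graphDirichlet_functional (E : Type) [NormedAddCommGroup E] [NormedSpace ℂ E]
    [CompleteSpace E] (p : L2 E × L2 E) (hp : p ∈ graphDirichlet E) (h0 : p.1 = 0) : p.2 = 0 := by
  obtain ⟨f', f'', c₁, hw, he⟩ := hp
  obtain ⟨h1, -⟩ := hw.1.eq_zero h0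
  obtain ⟨h3, -⟩ := hw.2.eq_zero h1
  rw [he, h3, neg_zero]

/-- The Dirichlet operator `H_∞` in `L₂(ℝ₊, E)`; it is used for `E = ℂ` and for `E = ℂ²`. -/
def opDirichlet (E : Type) [NormedAddCommGroup E] [NormedSpace ℂ E] : L2 E →ₗ.[ℂ] L2 E :=
  (graphDirichlet E).toLinearPMap

theorem opDirichlet_graph (E : Type) [NormedAddCommGroup E] [NormedSpace ℂ E] [CompleteSpace E] :
    (opDirichlet E).graph = graphDirichlet E :=
  Submodule.toLinearPMap_graph_eq _ (graphDirichlet_functional E)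

/-- `(T - lam I)⁻¹ g`: the solution `v` of `T v - lam v = g` (which exists and is unique if `lam`
belongs to the resolvent set of `T`). -/
def resolventApply {V : Type} [AddCommGroup V] [Module ℂ V] (T : V →ₗ.[ℂ] V) (lam : ℂ) (g : V) :
    V := by
  classical
  exact if h : ∃ v : T.domain, T v - lam • (v : V) = g then (h.choose : V) else 0

/-! ### Inner functions and the isometries `ψ(𝓑)` -/

/-- The boundary value `ψ(δ) = lim_{y → 0+} ψ(δ + i y)` on the real line. -/
def bdry (ψ : ℂ → ℂ) (δ : ℝ) : ℂ :=
  limUnder (𝓝[>] (0 : ℝ)) fun y : ℝ => ψ ((δ : ℂ) + (y : ℂ) * Complex.I)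

/-- `ψ ∈ H^∞(ℂ₊)` is inner: holomorphic and bounded by one in the open upper half-plane, with
boundary values of modulus one at almost every point of the real line. -/
structure IsInnerFunction (ψ : ℂ → ℂ) : Prop where
  differentiableOn : DifferentiableOn ℂ ψ {z : ℂ | 0 < z.im}
  norm_le_one : ∀ z : ℂ, 0 < z.im → ‖ψ z‖ ≤ 1
  boundary : ∀ᵐ δ : ℝ, ∃ w : ℂ, ‖w‖ = 1 ∧
    Tendsto (fun y : ℝ => ψ ((δ : ℂ) + (y : ℂ) * Complex.I)) (𝓝[>] (0 : ℝ)) (𝓝 w)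

/-- `ψ(𝓑) = F⁻¹ ψ(δ) F` on `L₂(ℝ₊)`, where `F f(δ) = (2π)^{-1/2} ∫ e^{iδs} f(s) ds` and functions
on `ℝ₊` are extended by zero to `ℝ`. Mathlib's Fourier transform is
`𝓕 f(ξ) = ∫ e^{-2πiξs} f(s) ds`, so multiplication by `ψ(δ)` after `F` is multiplication by
`ψ(-2πξ)` after `𝓕`. -/
def innerOp (ψ : ℂ → ℂ) (f : L2 ℂ) : L2 ℂ :=
  let fhat : Lp ℂ 2 (volume : Measure ℝ) :=
    𝓕 (toL2 (volume : Measure ℝ) ((Ioi (0 : ℝ)).indicator f))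
  let ghat : Lp ℂ 2 (volume : Measure ℝ) :=
    toL2 (volume : Measure ℝ) fun ξ : ℝ => bdry ψ (-(2 * Real.pi * ξ)) * fhat ξ
  toL2 ((volume : Measure ℝ).restrict (Ioi 0)) (𝓕⁻ ghat : Lp ℂ 2 (volume : Measure ℝ))

/-- The component `q_j ∈ L₂(ℝ₊)` of `q ∈ L₂(ℝ₊, ℂ²)`. -/
def comp (q : L2 C2) (j : Fin 2) : L2 ℂ :=
  toL2 ((volume : Measure ℝ).restrict (Ioi 0)) fun x => q x j

/-- The pairs `ψ₁, ψ₂` that are admitted for `q`: each `ψ_j` is an inner function or zero, they are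
not both zero, and the subspace `ψ_j(𝓑) L₂(ℝ₊)` is orthogonal to `q_j`. Then
`ψ₁(𝓑) L₂(ℝ₊) ⊕ ψ₂(𝓑) L₂(ℝ₊)` is a nonzero subspace orthogonal to `q`. -/
structure IsAdmissible (q : L2 C2) (ψ : Fin 2 → ℂ → ℂ) : Prop where
  inner_or_zero : ∀ j, IsInnerFunction (ψ j) ∨ ψ j = 0
  exists_inner : ∃ j, IsInnerFunction (ψ j)
  orthogonal : ∀ (j : Fin 2) (f : L2 ℂ), pairing (innerOp (ψ j) f) (comp q j) = 0

/-- `Ψ` is the holomorphic continuation into `ℂ₋`, with values of modulus at most one, of the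
function `ψ(-δ) / ψ(δ)` on the real line (which is the function `0` if `ψ = 0`). -/
structure IsContinuation (ψ Ψ : ℂ → ℂ) : Prop where
  differentiableOn : DifferentiableOn ℂ Ψ {z : ℂ | z.im < 0}
  norm_le_one : ∀ z : ℂ, z.im < 0 → ‖Ψ z‖ ≤ 1
  boundary : ∀ᵐ δ : ℝ, Tendsto (fun y : ℝ => Ψ ((δ : ℂ) - (y : ℂ) * Complex.I)) (𝓝[>] (0 : ℝ))
    (𝓝 (bdry ψ (-δ) / bdry ψ δ))

/-! ### The `S`-matrix -/

/-- The function `e^{-iμx}` of `L₂(ℝ₊)`, for `μ ∈ ℂ₋`. -/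
def expFun (μ : ℂ) : L2 ℂ :=
  toL2 ((volume : Measure ℝ).restrict (Ioi 0)) fun x : ℝ => Complex.exp (-(Complex.I * μ * x))

/-- The Weyl-Titchmarsh function
`W(z²) = -2iz - 2 (e^{-izx}, Re q)₊ + ((H_∞ - z² I)⁻¹ q, q)₊`, as a function of `z ∈ ℂ₋`. -/
def weyl (q : L2 C2) (z : ℂ) : ℂ :=
  -(2 * Complex.I * z)
    - 2 * (∫ x in Ioi (0 : ℝ), Complex.exp (-(Complex.I * z * x)) *
        (((q x 0).re : ℂ) + ((q x 1).re : ℂ)))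
    + pairing (resolventApply (opDirichlet C2) (z ^ 2) q) q

/-- `c(μ, q_j) = conj ψ_j(conj μ) + 2 (Im μ) ((H_∞ - μ² I)⁻¹ q_j, ψ_j(𝓑) e^{-iμx})₊`, `μ ∈ ℂ₋`. -/
def coeff (q : L2 C2) (ψ : Fin 2 → ℂ → ℂ) (μ : ℂ) (j : Fin 2) : ℂ :=
  conj (ψ j (conj μ))
    + 2 * (μ.im : ℂ) *
      pairing (resolventApply (opDirichlet ℂ) (μ ^ 2) (comp q j)) (innerOp (ψ j) (expFun μ))

/-- The matrix `diag(Ψ₁(z), Ψ₂(z)) - 2zi / (a - W(z²)) (c(z, q_i) conj c(-conj z, q_j))_{i,j}`. -/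
def sFormula (ψ Ψ : Fin 2 → ℂ → ℂ) (a : ℂ) (q : L2 C2) (z : ℂ) : Matrix (Fin 2) (Fin 2) ℂ :=
  Matrix.diagonal (fun j => Ψ j z)
    - (2 * z * Complex.I / (a - weyl q z)) •
      Matrix.of fun i j => coeff q ψ z i * conj (coeff q ψ (-conj z) j)

/-- The `S`-matrix of an operator `H` of the form `H_{a q}` (the operator determines `a` and `q`);
it is `0` by convention for an operator `H` that is not of this form. -/
def sMatrix (ψ Ψ : Fin 2 → ℂ → ℂ) (H : L2 C2 →ₗ.[ℂ] L2 C2) (z : ℂ) :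
    Matrix (Fin 2) (Fin 2) ℂ := by
  classical
  exact if h : ∃ p : ℂ × L2 C2, H = opH p.1 p.2 then
    sFormula ψ Ψ h.choose.1 h.choose.2 z else 0

end NonlocalDelta

end

/-! Transposing and conjugating the S-matrix interchanges the factors `c(z, ·)` and `c(-conj z, ·)`
of its rank-one part, and `conj (2zi) = 2(-conj z)i`. The matrix identity thus reduces to two scalar
symmetries under `z ↦ -conj z`. For the Weyl function, `weyl_neg_conj` uses that the Dirichlet
operator is symmetric, so that its resolvents at `z²` and `conj z²` are adjoint to each other, and
that the integral term contains a real function. For `Ψ_j`, `IsContinuation.neg_conj` compares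
boundary values: an inner function has modulus one on the line, where conjugation is inversion. The
difference of the two sides is bounded and holomorphic with zero boundary limits almost everywhere,
hence zero by `eq_zero_of_ae_boundary_zero`. The adjoint is `H_{conj a, q}` (`opH_adjoint`). Green's
formula makes `H_{a q}` and `H_{conj a, q}` formally adjoint. Adding a common large `κ²` makes both
surjective, which gives density of the domain and maximality of the formal adjoint. Surjectivity
comes from the factorization `k² - d²/dx² = (k - d/dx)(k + d/dx)` into two first-order equations
solved in `L₂`. Finally, `opH_injective` makes the S-matrix of an operator independent of the chosen
parameters `a`, `q`. -/

noncomputable section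

namespace NonlocalDelta

/-! ### Absolutely continuous functions on the half-line -/

section ProductRule

variable {E F G : Type*} [NormedAddCommGroup E] [NormedSpace ℝ E] [CompleteSpace E]
  [NormedAddCommGroup F] [NormedSpace ℝ F] [CompleteSpace F]
  [NormedAddCommGroup G] [NormedSpace ℝ G] [CompleteSpace G]

/-- Fubini for `B (f s) (g t)` on the square `(0, x]²`, cut along the diagonal into the triangles `t
≤ s` and `s < t`. -/
theorem integral_bilin_triangle (B : E →L[ℝ] F →L[ℝ] G) {f : ℝ → E} {g : ℝ → F} {x : ℝ}
    (hx : 0 ≤ x) (hf : IntervalIntegrable f volume 0 x) (hg : IntervalIntegrable g volume 0 x) :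
    IntervalIntegrable (fun s => B (f s) (∫ t in (0 : ℝ)..s, g t)) volume 0 x ∧
    IntervalIntegrable (fun t => B (∫ s in (0 : ℝ)..t, f s) (g t)) volume 0 x ∧
    B (∫ t in (0 : ℝ)..x, f t) (∫ t in (0 : ℝ)..x, g t) =
      (∫ s in (0 : ℝ)..x, B (f s) (∫ t in (0 : ℝ)..s, g t))
        + ∫ t in (0 : ℝ)..x, B (∫ s in (0 : ℝ)..t, f s) (g t) := by
  simp only [intervalIntegrable_iff_integrableOn_Ioc_of_le hx] at *
  set μ : Measure ℝ := volume.restrict (Ioc 0 x) with hμ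
  set K : ℝ × ℝ → G := fun z => B (f z.1) (g z.2) with hK
  have hKi : Integrable K (μ.prod μ) :=
    Integrable.op_fst_snd (op := fun a b => B a b) (by fun_prop) ⟨‖B‖, B.le_opNorm₂⟩ hf hg
  set S : Set (ℝ × ℝ) := {z | z.2 ≤ z.1} with hS
  have hSm : MeasurableSet S := measurableSet_le measurable_snd measurable_fst
  have h1 : ∀ᵐ s ∂μ, ∫ t, S.indicator K (s, t) ∂μ = B (f s) (∫ t in (0 : ℝ)..s, g t) := by
    filter_upwards [ae_restrict_mem measurableSet_Ioc] with s hs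
    have e : (fun t => S.indicator K (s, t)) = (Iic s).indicator fun t => B (f s) (g t) := by
      ext t
      by_cases h : t ≤ s <;> simp [indicator, hS, hK, h]
    have e2 : Ioc 0 x ∩ Iic s = Ioc 0 s := by
      ext t; simp only [mem_inter_iff, mem_Ioc, mem_Iic]; grind
    rw [e, setIntegral_indicator measurableSet_Iic, e2,
      ContinuousLinearMap.integral_comp_comm _ (IntegrableOn.mono_set hg (Ioc_subset_Ioc_right hs.2)),
      intervalIntegral.integral_of_le hs.1.le]
  have h2 : ∀ᵐ t ∂μ, ∫ s, Sᶜ.indicator K (s, t) ∂μ = B (∫ s in (0 : ℝ)..t, f s) (g t) := by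
    filter_upwards [ae_restrict_mem measurableSet_Ioc] with t ht
    have e : (fun s => Sᶜ.indicator K (s, t)) = (Iio t).indicator fun s => B.flip (g t) (f s) := by
      ext s
      by_cases h : t ≤ s <;> simp [indicator, hS, hK, h, not_lt.2, lt_of_not_ge]
    have e2 : Ioc 0 x ∩ Iio t = Ioo 0 t := by
      ext s; simp only [mem_inter_iff, mem_Ioc, mem_Iio, mem_Ioo]; grind
    rw [e, setIntegral_indicator measurableSet_Iio, e2, ← integral_Ioc_eq_integral_Ioo,
      ContinuousLinearMap.integral_comp_comm _ (IntegrableOn.mono_set hf (Ioc_subset_Ioc_right ht.2)),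
      intervalIntegral.integral_of_le ht.1.le, ContinuousLinearMap.flip_apply]
  have hi1 := hKi.indicator hSm
  have hi2 := hKi.indicator hSm.compl
  refine ⟨hi1.integral_prod_left.congr h1, hi2.integral_prod_right.congr h2, ?_⟩
  simp only [intervalIntegral.integral_of_le hx]
  rw [← integral_prod_bilin B hf hg, ← integral_congr_ae h1, ← integral_congr_ae h2,
    ← integral_prod _ hi1, ← integral_prod_symm _ hi2, integral_indicator hSm,
    integral_indicator hSm.compl, integral_add_compl hSm hKi]

/-- The product rule for absolutely continuous functions, in integrated form. -/
theorem bilin_primitive (B : E →L[ℝ] F →L[ℝ] G) {f : ℝ → E} {g : ℝ → F} {x : ℝ}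
    (hx : 0 ≤ x) (hf : IntervalIntegrable f volume 0 x) (hg : IntervalIntegrable g volume 0 x)
    (c : E) (d : F) :
    B (c + ∫ t in (0 : ℝ)..x, f t) (d + ∫ t in (0 : ℝ)..x, g t) =
      B c d + ∫ s in (0 : ℝ)..x, (B (f s) (d + ∫ t in (0 : ℝ)..s, g t)
        + B (c + ∫ t in (0 : ℝ)..s, f t) (g s)) := by
  obtain ⟨i1, i2, e⟩ := integral_bilin_triangle B hx hf hg
  have j1 : IntervalIntegrable (fun s => B.flip d (f s)) volume 0 x := by
    rw [intervalIntegrable_iff_integrableOn_Ioc_of_le hx] at *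
    exact (B.flip d).integrable_comp hf
  have j2 : IntervalIntegrable (fun s => B c (g s)) volume 0 x := by
    rw [intervalIntegrable_iff_integrableOn_Ioc_of_le hx] at *
    exact (B c).integrable_comp hg
  have k : ∀ s, B (f s) (d + ∫ t in (0 : ℝ)..s, g t) + B (c + ∫ t in (0 : ℝ)..s, f t) (g s)
      = (B.flip d (f s) + B c (g s)) + (B (f s) (∫ t in (0 : ℝ)..s, g t)
        + B (∫ t in (0 : ℝ)..s, f t) (g s)) := by
    intro s
    simp only [map_add, add_apply, ContinuousLinearMap.flip_apply]
    abel
  simp only [k]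
  rw [intervalIntegral.integral_add (j1.add j2) (i1.add i2), intervalIntegral.integral_add j1 j2,
    intervalIntegral.integral_add i1 i2, ← e, ContinuousLinearMap.intervalIntegral_comp_comm _ hf,
    ContinuousLinearMap.intervalIntegral_comp_comm _ hg]
  simp only [map_add, add_apply, ContinuousLinearMap.flip_apply]
  abel

/-- Variation of parameters for `y' = m y + h`, `y(0) = c`. -/
theorem variation_of_parameters {E : Type*} [NormedAddCommGroup E] [NormedSpace ℂ E]
    [CompleteSpace E] (m : ℂ) {h : ℝ → E} {x : ℝ} (hx : 0 ≤ x)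
    (hh : IntervalIntegrable h volume 0 x) (c : E) :
    Complex.exp (m * x) • (c + ∫ t in (0 : ℝ)..x, Complex.exp (-(m * t)) • h t) =
      c + ∫ s in (0 : ℝ)..x, (m • (Complex.exp (m * s) •
        (c + ∫ t in (0 : ℝ)..s, Complex.exp (-(m * t)) • h t)) + h s) := by
  have hexp : ∀ y : ℝ, Complex.exp (m * y)
      = 1 + ∫ t in (0 : ℝ)..y, m * Complex.exp (m * t) := by
    intro y
    have hd : ∀ t : ℝ, HasDerivAt (fun t : ℝ => Complex.exp (m * t)) (m * Complex.exp (m * t)) t := by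
      intro t
      have h0 : HasDerivAt (fun z : ℂ => Complex.exp (m * z)) (m * Complex.exp (m * t)) (t : ℂ) := by
        simpa [mul_comm] using ((hasDerivAt_id (t : ℂ)).const_mul m).cexp
      exact h0.comp_ofReal
    rw [intervalIntegral.integral_eq_sub_of_hasDerivAt (fun t _ => hd t)
      (Continuous.intervalIntegrable (by fun_prop) _ _)]
    simp
  have hi1 : IntervalIntegrable (fun t : ℝ => m * Complex.exp (m * t)) volume 0 x :=
    Continuous.intervalIntegrable (by fun_prop) _ _
  have hi2 : IntervalIntegrable (fun t : ℝ => Complex.exp (-(m * t)) • h t) volume 0 x :=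
    hh.continuousOn_smul (Continuous.continuousOn (by fun_prop))
  -- Product rule for `e^{mx}` times the bracket; in the second term `e^{ms}` and `e^{-ms}` cancel
  -- and leave `h s`.
  have := bilin_primitive (ContinuousLinearMap.lsmul ℝ ℂ : ℂ →L[ℝ] E →L[ℝ] E) hx hi1 hi2 1 c
  simp only [ContinuousLinearMap.lsmul_apply, one_smul, ← hexp] at this
  rw [this]
  congr 1
  apply intervalIntegral.integral_congr
  intro s _
  simp only [smul_smul, ← Complex.exp_add, add_neg_cancel, Complex.exp_zero, one_smul]

end ProductRule

/-! ### First-order equations in `L₂(ℝ₊, E)` -/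

section Normed

theorem L2.intervalIntegrable_indicator {E : Type} [NormedAddCommGroup E] (h : L2 E) (a b : ℝ) :
    IntervalIntegrable ((Ioi (0 : ℝ)).indicator h) volume a b := by
  have hg2 : MemLp ((Ioi (0 : ℝ)).indicator h) 2 volume :=
    (memLp_indicator_iff_restrict measurableSet_Ioi).2 (Lp.memLp h)
  exact ((hg2.locallyIntegrable (by norm_num)).integrableOn_isCompact
    isCompact_uIcc).intervalIntegrable

variable {E : Type} [NormedAddCommGroup E] [NormedSpace ℂ E]

theorem intervalIntegral_congr_of_ae_Ioi {f g : ℝ → E}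
    (h : f =ᵐ[(volume : Measure ℝ).restrict (Ioi 0)] g) {x : ℝ} (hx : 0 ≤ x) :
    ∫ t in (0 : ℝ)..x, f t = ∫ t in (0 : ℝ)..x, g t := by
  apply intervalIntegral.integral_congr_ae
  filter_upwards [(ae_restrict_iff' measurableSet_Ioi).1 h] with t ht hmem
  rw [uIoc_of_le hx] at hmem
  exact ht hmem.1

theorem IsW1.sub {f f' g g' : L2 E} {c d : E}
    (hf : IsW1 f f' c) (hg : IsW1 g g' d) : IsW1 (f - g) (f' - g') (c - d) := by
  simpa [sub_eq_add_neg] using hf.add (hg.smul (-1))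

theorem IsW1.unique [CompleteSpace E] {f f' g' : L2 E} {c d : E}
    (hf : IsW1 f f' c) (hg : IsW1 f g' d) : f' = g' ∧ c = d := by
  obtain ⟨h1, h2⟩ := (hf.sub hg).eq_zero (sub_self f)
  exact ⟨sub_eq_zero.1 h1, sub_eq_zero.1 h2⟩

/-- Solutions `w` and `u` of two first-order equations give the solution of `-u'' + k² u = g`,
`u(0) = c`. -/
theorem isW2_of_first_order {k : ℂ} {u w g : L2 E} {c d : E} (hw : IsW1 w (k • w - g) d)
    (hu : IsW1 u (w - k • u) c) :
    IsW2 u (w - k • u) (k ^ 2 • u - g) c (d - k • c) := by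
  refine ⟨hu, ?_⟩
  convert hw.sub (hu.smul k) using 1
  rw [smul_sub, smul_smul, sq]
  abel

end Normed

/-! ### Energy estimates, Green's formula and the Dirichlet resolvent. -/

section Inner

variable {E : Type} [NormedAddCommGroup E] [InnerProductSpace ℂ E] [CompleteSpace E]

theorem inner_primitive {f g : ℝ → E} {x : ℝ} (hx : 0 ≤ x)
    (hf : IntervalIntegrable f volume 0 x) (hg : IntervalIntegrable g volume 0 x) (c d : E) :
    inner ℂ (c + ∫ t in (0 : ℝ)..x, f t) (d + ∫ t in (0 : ℝ)..x, g t) =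
      inner ℂ c d + ∫ s in (0 : ℝ)..x, (inner ℂ (f s) (d + ∫ t in (0 : ℝ)..s, g t)
        + inner ℂ (c + ∫ t in (0 : ℝ)..s, f t) (g s)) := by
  have := bilin_primitive
    (isBoundedBilinearMap_inner (𝕜 := ℂ) (E := E)).toContinuousLinearMap hx hf hg c d
  simpa only [IsBoundedBilinearMap.toContinuousLinearMap_apply] using this

/-- Integrate `(‖y‖²)' = 2 Re m ‖y‖² + 2 Re ⟨y, h⟩` and absorb the mixed term by `2‖y‖‖h‖ ≤ κ‖y‖² +
κ⁻¹‖h‖²`. The sign `σ` of `Re m` lets one estimate serve decaying and growing equations. -/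
theorem energy_estimate {m : ℂ} {κ σ : ℝ} (hκ : 0 < κ) (hσ : σ = 1 ∨ σ = -1) (hm : m.re = σ * κ)
    {y h : ℝ → E} {c : E} (hy : Continuous y) {x : ℝ} (hx : 0 ≤ x)
    (hh : IntervalIntegrable h volume 0 x)
    (hh2 : IntervalIntegrable (fun t => ‖h t‖ ^ 2) volume 0 x)
    (hode : ∀ s, 0 ≤ s → y s = c + ∫ t in (0 : ℝ)..s, (m • y t + h t)) :
    κ * (∫ t in (0 : ℝ)..x, ‖y t‖ ^ 2)
      ≤ σ * (‖y x‖ ^ 2 - ‖c‖ ^ 2) + κ⁻¹ * ∫ t in (0 : ℝ)..x, ‖h t‖ ^ 2 := by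
  have hi : IntervalIntegrable (fun t => m • y t + h t) volume 0 x :=
    (Continuous.intervalIntegrable (by fun_prop) _ _).add hh
  have h1 := inner_primitive hx hi hi c c
  rw [← hode x hx] at h1
  have h2 : ∫ s in (0 : ℝ)..x, (inner ℂ (m • y s + h s) (c + ∫ t in (0 : ℝ)..s, (m • y t + h t))
        + inner ℂ (c + ∫ t in (0 : ℝ)..s, (m • y t + h t)) (m • y s + h s))
      = ((∫ s in (0 : ℝ)..x, 2 * (inner ℂ (y s) (m • y s + h s)).re : ℝ) : ℂ) := by
    rw [← intervalIntegral.integral_ofReal]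
    apply intervalIntegral.integral_congr
    intro s hs
    rw [uIcc_of_le hx] at hs
    simp only [← hode s hs.1]
    rw [← inner_conj_symm, add_comm, Complex.add_conj]
  rw [h2, inner_self_eq_norm_sq_to_K, inner_self_eq_norm_sq_to_K] at h1
  have h3 : ‖y x‖ ^ 2 = ‖c‖ ^ 2 + ∫ s in (0 : ℝ)..x, 2 * (inner ℂ (y s) (m • y s + h s)).re := by
    have := congrArg Complex.re h1
    simpa [← Complex.ofReal_pow] using this
  have i1 : IntervalIntegrable (fun t => κ * ‖y t‖ ^ 2) volume 0 x :=
    Continuous.intervalIntegrable (by fun_prop) _ _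
  have i2 : IntervalIntegrable (fun t => (inner ℂ (y t) (m • y t + h t))) volume 0 x := by
    have hcont : IntervalIntegrable (fun t => inner ℂ (y t) (m • y t)) volume 0 x :=
      Continuous.intervalIntegrable (by fun_prop) _ _
    have hmix : IntervalIntegrable (fun t => inner ℂ (y t) (h t)) volume 0 x := by
      obtain ⟨C, hC⟩ := isCompact_uIcc.exists_bound_of_continuousOn (f := y) (s := uIcc 0 x)
        hy.continuousOn
      rw [intervalIntegrable_iff] at hh ⊢
      refine Integrable.mono' (hh.norm.const_mul C)
        (hy.aestronglyMeasurable.inner hh.aestronglyMeasurable) ?_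
      filter_upwards [ae_restrict_mem measurableSet_uIoc] with t ht
      refine (norm_inner_le_norm _ _).trans ?_
      gcongr
      exact hC t (uIoc_subset_uIcc ht)
    simpa only [inner_add_right] using hcont.add hmix
  have i3 : IntervalIntegrable (fun t => 2 * (inner ℂ (y t) (m • y t + h t)).re) volume 0 x := by
    rw [intervalIntegrable_iff] at i2 ⊢
    exact i2.re.const_mul 2
  have h4 : ∫ t in (0 : ℝ)..x, κ * ‖y t‖ ^ 2 ≤ ∫ t in (0 : ℝ)..x,
      (σ * (2 * (inner ℂ (y t) (m • y t + h t)).re) + κ⁻¹ * ‖h t‖ ^ 2) := by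
    apply intervalIntegral.integral_mono hx i1 ((i3.const_mul σ).add (hh2.const_mul κ⁻¹))
    intro t
    have e : (inner ℂ (y t) (m • y t + h t)).re = m.re * ‖y t‖ ^ 2 + (inner ℂ (y t) (h t)).re := by
      rw [inner_add_right, inner_smul_right, inner_self_eq_norm_sq_to_K]
      simp [← Complex.ofReal_pow]
    have b : |(inner ℂ (y t) (h t)).re| ≤ ‖y t‖ * ‖h t‖ :=
      (Complex.abs_re_le_norm _).trans (norm_inner_le_norm _ _)
    have hsq : 2 * (‖y t‖ * ‖h t‖) ≤ κ * ‖y t‖ ^ 2 + κ⁻¹ * ‖h t‖ ^ 2 := by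
      have := mul_nonneg (inv_nonneg.2 hκ.le) (sq_nonneg (κ * ‖y t‖ - ‖h t‖))
      have e : κ⁻¹ * (κ * ‖y t‖ - ‖h t‖) ^ 2
          = κ * ‖y t‖ ^ 2 + κ⁻¹ * ‖h t‖ ^ 2 - 2 * (‖y t‖ * ‖h t‖) := by
        field_simp
        ring
      linarith
    obtain ⟨b1, b2⟩ := abs_le.1 b
    simp only [e, hm]
    rcases hσ with rfl | rfl <;> linarith
  rw [intervalIntegral.integral_add (i3.const_mul σ) (hh2.const_mul κ⁻¹),
    intervalIntegral.integral_const_mul σ] at h4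
  rw [h3, add_sub_cancel_left]
  simpa only [intervalIntegral.integral_const_mul κ,
    intervalIntegral.integral_const_mul κ⁻¹] using h4

/-- Square integrability of the solution of `y' = m y + h`, `y(0) = c`. -/
theorem exists_isW1_of_bound {m : ℂ} {κ σ : ℝ} (hκ : 0 < κ) (hσ : σ = 1 ∨ σ = -1)
    (hm : m.re = σ * κ) (h : L2 E) (c : E) (C : ℝ)
    (hC : ∀ x : ℝ, 0 ≤ x → σ * ‖Complex.exp (m * x) •
      (c + ∫ t in (0 : ℝ)..x, Complex.exp (-(m * t)) • (Ioi (0 : ℝ)).indicator h t)‖ ^ 2 ≤ C) :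
    ∃ u : L2 E, IsW1 u (m • u + h) c := by
  set g : ℝ → E := (Ioi (0 : ℝ)).indicator h with hg
  have hgi : ∀ a b, IntervalIntegrable g volume a b := L2.intervalIntegrable_indicator h
  have hgh : g =ᵐ[(volume : Measure ℝ).restrict (Ioi 0)] h := indicator_ae_eq_restrict measurableSet_Ioi
  have hgi' : ∀ a b, IntervalIntegrable (fun t : ℝ => Complex.exp (-(m * t)) • g t) volume a b :=
    fun a b => (hgi a b).continuousOn_smul (Continuous.continuousOn (by fun_prop))
  set y : ℝ → E := fun x => Complex.exp (m * x) •
      (c + ∫ t in (0 : ℝ)..x, Complex.exp (-(m * t)) • g t) with hy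
  have hyc : Continuous y := by
    have := intervalIntegral.continuous_primitive hgi' 0
    fun_prop
  have hode : ∀ s, 0 ≤ s → y s = c + ∫ t in (0 : ℝ)..s, (m • y t + g t) :=
    fun s hs => variation_of_parameters m hs (hgi 0 s) c
  have hg2 : Integrable (fun t => ‖g t‖ ^ 2) volume := by
    have hg2 : MemLp g 2 volume := (memLp_indicator_iff_restrict measurableSet_Ioi).2 (Lp.memLp h)
    exact (memLp_two_iff_integrable_sq_norm hg2.1).1 hg2
  -- The explicit solution is square integrable because the energy estimate bounds `∫₀ˣ ‖y‖²`
  -- independently of `x`; `hC` controls the boundary term `σ‖y x‖²`.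
  have hyL : MemLp y 2 ((volume : Measure ℝ).restrict (Ioi 0)) := by
    rw [memLp_two_iff_integrable_sq_norm hyc.aestronglyMeasurable]
    refine integrableOn_Ioi_of_intervalIntegral_norm_bounded (b := fun x : ℝ => x) (l := atTop)
      (κ⁻¹ * (C - σ * ‖c‖ ^ 2 + κ⁻¹ * ∫ t, ‖g t‖ ^ 2)) 0
      (fun i => (Continuous.integrableOn_Icc (by fun_prop)).mono_set Ioc_subset_Icc_self)
      tendsto_id ?_
    filter_upwards [eventually_ge_atTop 0] with x hx
    have he := energy_estimate hκ hσ hm hyc hx (hgi 0 x) hg2.intervalIntegrable hode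
    have h2 : ∫ t in (0 : ℝ)..x, ‖g t‖ ^ 2 ≤ ∫ t, ‖g t‖ ^ 2 := by
      rw [intervalIntegral.integral_of_le hx]
      exact setIntegral_le_integral hg2 (Eventually.of_forall fun t => by positivity)
    have h3 : κ⁻¹ * ∫ t in (0 : ℝ)..x, ‖g t‖ ^ 2 ≤ κ⁻¹ * ∫ t, ‖g t‖ ^ 2 := by gcongr
    rw [inv_mul_eq_div, le_div_iff₀ hκ]
    simp only [norm_pow, norm_norm]
    have := hC x hx
    linarith
  refine ⟨hyL.toLp y, ?_⟩
  filter_upwards [hyL.coeFn_toLp, ae_restrict_mem measurableSet_Ioi] with x h1 hx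
  rw [h1, hode x (le_of_lt hx)]
  congr 1
  apply intervalIntegral_congr_of_ae_Ioi _ (le_of_lt hx)
  filter_upwards [hyL.coeFn_toLp, hgh, Lp.coeFn_add (m • hyL.toLp y) h,
    Lp.coeFn_smul m (hyL.toLp y)] with t h1 h2 h3 h4
  rw [h3, Pi.add_apply, h4, Pi.smul_apply, h1, h2]

/-- The forward equation `u' = w - k u` is solvable for any initial value. -/
theorem exists_isW1_forward {k : ℂ} (hk : 0 < k.re) (w : L2 E) (c : E) :
    ∃ u : L2 E, IsW1 u (w - k • u) c := by
  -- For a decaying equation the boundary term `-‖y x‖²` is nonpositive, so `C = 0` works for every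
  -- initial value.
  obtain ⟨u, hu⟩ := exists_isW1_of_bound (m := -k) (σ := -1) hk (Or.inr rfl) (by simp) w c 0
    (fun x _ => by nlinarith [sq_nonneg ‖Complex.exp (-k * x) • (c + ∫ t in (0 : ℝ)..x,
      Complex.exp (-(-k * t)) • (Ioi (0 : ℝ)).indicator w t)‖])
  refine ⟨u, ?_⟩
  convert hu using 1
  rw [neg_smul]; abel

/-- The backward equation `w' = k w - g` is solvable for a suitable initial value. -/
theorem exists_isW1_backward {k : ℂ} (hk : 0 < k.re) (g : L2 E) :
    ∃ (w : L2 E) (c : E), IsW1 w (k • w - g) c := by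
  set p : ℝ → E := (Ioi (0 : ℝ)).indicator (-g : L2 E) with hp
  have hp2 : MemLp p 2 volume :=
    (memLp_indicator_iff_restrict measurableSet_Ioi).2 (Lp.memLp (-g : L2 E))
  have hpi : Integrable (fun t => ‖p t‖ ^ 2) volume := (memLp_two_iff_integrable_sq_norm hp2.1).1 hp2
  have hexp : ∀ x : ℝ, IntegrableOn (fun t : ℝ => Real.exp (-(2 * k.re) * t)) (Ioi x) := fun x =>
    integrableOn_exp_mul_Ioi (by linarith) x
  have hnorm : ∀ t : ℝ, ‖Complex.exp (-(k * t)) • p t‖ = Real.exp (-(k.re * t)) * ‖p t‖ := by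
    intro t
    rw [norm_smul, Complex.norm_exp]
    simp
  -- With `s = e^{Re k (x - t)}` this is `s‖p‖ ≤ s² + ‖p‖²`; the extracted factor `e^{-Re k x}` will
  -- cancel the growth of `e^{kx}`.
  have hpoint : ∀ x t : ℝ, ‖Complex.exp (-(k * t)) • p t‖ ≤
      Real.exp (-(k.re * x)) * (Real.exp (2 * k.re * x) * Real.exp (-(2 * k.re) * t)
        + ‖p t‖ ^ 2) := by
    intro x t
    rw [hnorm]
    have e1 : Real.exp (-(k.re * t)) = Real.exp (-(k.re * x)) * Real.exp (k.re * (x - t)) := by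
      rw [← Real.exp_add]; ring_nf
    have e2 : Real.exp (2 * k.re * x) * Real.exp (-(2 * k.re) * t) = Real.exp (k.re * (x - t)) ^ 2 := by
      rw [← Real.exp_add, ← Real.exp_nat_mul]; ring_nf
    rw [e1, e2, mul_assoc]
    gcongr
    nlinarith [sq_nonneg (Real.exp (k.re * (x - t)) - ‖p t‖), sq_nonneg (Real.exp (k.re * (x - t))),
      sq_nonneg ‖p t‖]
  have hint : ∀ x : ℝ, IntegrableOn (fun t : ℝ => Complex.exp (-(k * t)) • p t) (Ioi x) := by
    intro x
    refine Integrable.mono' ((((hexp x).const_mul (Real.exp (2 * k.re * x))).add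
      hpi.integrableOn).const_mul (Real.exp (-(k.re * x)))) ?_ (Eventually.of_forall (hpoint x))
    have : Continuous fun t : ℝ => Complex.exp (-(k * t)) := by fun_prop
    exact (this.aestronglyMeasurable.smul hp2.1).mono_measure Measure.restrict_le_self
  -- This initial value turns the bracket in the explicit solution into `-∫_x^∞ e^{-kt} p`, which is
  -- small enough to keep the solution bounded.
  set c : E := -∫ t in Ioi (0 : ℝ), Complex.exp (-(k * t)) • p t with hc
  obtain ⟨w, hw⟩ := exists_isW1_of_bound (m := k) (σ := 1) hk (Or.inl rfl) (by simp) (-g) c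
    (((2 * k.re)⁻¹ + ∫ t, ‖p t‖ ^ 2) ^ 2) (by
      intro x hx
      have e1 : c + ∫ t in (0 : ℝ)..x, Complex.exp (-(k * t)) • p t
          = -∫ t in Ioi x, Complex.exp (-(k * t)) • p t := by
        have := intervalIntegral.integral_Ioi_sub_Ioi (hint 0) hx
        rw [hc, ← this]
        abel
      rw [← hp, e1, one_mul, norm_smul, norm_neg, Complex.norm_exp]
      have e2 : ‖∫ t in Ioi x, Complex.exp (-(k * t)) • p t‖
          ≤ Real.exp (-(k.re * x)) * ((2 * k.re)⁻¹ + ∫ t, ‖p t‖ ^ 2) := by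
        refine (norm_integral_le_integral_norm _).trans ((integral_mono_of_nonneg
          (Eventually.of_forall fun t => norm_nonneg _) ((((hexp x).const_mul
          (Real.exp (2 * k.re * x))).add hpi.integrableOn).const_mul (Real.exp (-(k.re * x))))
          (Eventually.of_forall (hpoint x))).trans ?_)
        rw [integral_const_mul]
        gcongr
        refine (integral_add ((hexp x).const_mul (Real.exp (2 * k.re * x)))
          hpi.integrableOn).trans_le ?_
        gcongr ?_ + ?_
        · rw [integral_const_mul, integral_exp_mul_Ioi (by linarith), neg_div_neg_eq,
            ← mul_div_assoc, ← Real.exp_add]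
          simp
        · exact setIntegral_le_integral hpi (Eventually.of_forall fun t => by positivity)
      have e3 : Real.exp (k * x : ℂ).re * ‖∫ t in Ioi x, Complex.exp (-(k * t)) • p t‖
          ≤ (2 * k.re)⁻¹ + ∫ t, ‖p t‖ ^ 2 := by
        calc _ ≤ Real.exp (k * x : ℂ).re * (Real.exp (-(k.re * x)) *
              ((2 * k.re)⁻¹ + ∫ t, ‖p t‖ ^ 2)) := by gcongr
          _ = _ := by
            rw [← mul_assoc, ← Real.exp_add]
            simp
      gcongr)
  exact ⟨w, c, by simpa [sub_eq_add_neg] using hw⟩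

/-- Integration by parts on the half-line. -/
theorem IsW1.inner_add_inner {f f' g g' : L2 E} {c d : E} (hf : IsW1 f f' c) (hg : IsW1 g g' d) :
    inner ℂ f' g + inner ℂ f g' = -inner ℂ c d := by
  have i1 : IntegrableOn (fun t => inner ℂ (f' t) (g t)) (Ioi (0 : ℝ)) := L2.integrable_inner f' g
  have i2 : IntegrableOn (fun t => inner ℂ (f t) (g' t)) (Ioi (0 : ℝ)) := L2.integrable_inner f g'
  have i3 : IntegrableOn (fun t => inner ℂ (f t) (g t)) (Ioi (0 : ℝ)) := L2.integrable_inner f g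
  set H : ℝ → ℂ := fun x => inner ℂ (c + ∫ t in (0 : ℝ)..x, f' t) (d + ∫ t in (0 : ℝ)..x, g' t)
    with hH
  have hHi : IntegrableOn H (Ioi 0) := by
    refine i3.congr ?_
    filter_upwards [hf, hg] with t h1 h2
    rw [h1, h2]
  have e : ∀ x, 0 ≤ x → H x = inner ℂ c d
      + ∫ t in (0 : ℝ)..x, (inner ℂ (f' t) (g t) + inner ℂ (f t) (g' t)) := by
    intro x hx
    rw [hH]
    simp only
    rw [inner_primitive hx (L2.intervalIntegrable f' hx) (L2.intervalIntegrable g' hx)]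
    congr 1
    apply intervalIntegral_congr_of_ae_Ioi _ hx
    filter_upwards [hf, hg] with t h1 h2
    rw [← h1, ← h2]
  have hlim : Tendsto H atTop (𝓝 (inner ℂ c d
      + ∫ t in Ioi (0 : ℝ), (inner ℂ (f' t) (g t) + inner ℂ (f t) (g' t)))) := by
    refine ((intervalIntegral_tendsto_integral_Ioi 0 (i1.add i2) tendsto_id).const_add _).congr' ?_
    filter_upwards [eventually_ge_atTop 0] with x hx
    exact (e x hx).symm
  rw [integral_add i1 i2] at hlim
  change Tendsto H atTop (𝓝 (inner ℂ c d + (inner ℂ f' g + inner ℂ f g'))) at hlim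
  -- The inner product is integrable on the half-line and has a limit at infinity. A nonzero limit
  -- would keep it away from zero on a set of infinite measure.
  have hzero : inner ℂ c d + (inner ℂ f' g + inner ℂ f g') = 0 := by
    by_contra hne
    set L := inner ℂ c d + (inner ℂ f' g + inner ℂ f g') with hL
    have hLpos : 0 < ‖L‖ := norm_pos_iff.2 hne
    have hev := hlim.norm.eventually (lt_mem_nhds (half_lt_self hLpos))
    obtain ⟨X, hX⟩ := eventually_atTop.1 hev
    have hfin := hHi.measure_norm_ge_lt_top (half_pos hLpos)
    have hsub : Ioi (max X 0) ⊆ {x | ‖L‖ / 2 ≤ ‖H x‖} ∩ Ioi 0 := fun x hx =>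
      ⟨(hX x ((le_max_left _ _).trans (le_of_lt hx))).le, (le_max_right X 0).trans_lt hx⟩
    have := (measure_mono hsub).trans (Measure.le_restrict_apply (μ := volume) (Ioi (0 : ℝ)) {x | ‖L‖ / 2 ≤ ‖H x‖})
    rw [Real.volume_Ioi, top_le_iff] at this
    exact absurd this hfin.ne
  linear_combination hzero

/-- Green's formula on the half-line. -/
theorem IsW2.green {f f' f'' g g' g'' : L2 E} {c₀ c₁ d₀ d₁ : E} (hf : IsW2 f f' f'' c₀ c₁)
    (hg : IsW2 g g' g'' d₀ d₁) :
    inner ℂ f'' g - inner ℂ f g'' = inner ℂ c₀ d₁ - inner ℂ c₁ d₀ := by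
  linear_combination hf.2.inner_add_inner hg.1 - hf.1.inner_add_inner hg.2

/-- Solve `(k - d/dx) w = g` backward, then `(k + d/dx) u = w` forward with `u(0) = 0`. -/
theorem exists_mem_graphDirichlet {k : ℂ} (hk : 0 < k.re) (g : L2 E) :
    ∃ u : L2 E, (u, g - k ^ 2 • u) ∈ graphDirichlet E := by
  obtain ⟨w, d, hw⟩ := exists_isW1_backward hk g
  obtain ⟨u, hu⟩ := exists_isW1_forward hk w 0
  exact ⟨u, _, _, _, isW2_of_first_order hw hu, by simp⟩

theorem inner_graphDirichlet {p r : L2 E × L2 E} (hp : p ∈ graphDirichlet E)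
    (hr : r ∈ graphDirichlet E) : inner ℂ p.2 r.1 = inner ℂ p.1 r.2 := by
  obtain ⟨f', f'', c, hf, ef⟩ := hp
  obtain ⟨g', g'', d, hg, eg⟩ := hr
  have := hf.green hg
  rw [ef, eg, inner_neg_left, inner_neg_right]
  simp only [inner_zero_left, inner_zero_right] at this
  linear_combination -this

/-- The resolvent of the Dirichlet operator at `z²`, `z ∈ ℂ₋`. -/
theorem resolventApply_opDirichlet {z : ℂ} (hz : z.im < 0) (g : L2 E) :
    (resolventApply (opDirichlet E) (z ^ 2) g,
      g + z ^ 2 • resolventApply (opDirichlet E) (z ^ 2) g) ∈ graphDirichlet E := by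
  have hex : ∃ v : (opDirichlet E).domain, opDirichlet E v - z ^ 2 • (v : L2 E) = g := by
    -- `k = iz` has `Re k = -Im z > 0` and `k² = -z²`.
    obtain ⟨u, hu⟩ := exists_mem_graphDirichlet (k := Complex.I * z) (by simpa using hz) g
    rw [← opDirichlet_graph, LinearPMap.mem_graph_iff] at hu
    obtain ⟨v, hv, hv'⟩ := hu
    refine ⟨v, ?_⟩
    simp only at hv hv'
    rw [hv', hv, mul_pow, Complex.I_sq]
    simp
  have h1 := hex.choose_spec
  rw [resolventApply, dif_pos hex, ← opDirichlet_graph, LinearPMap.mem_graph_iff]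
  exact ⟨hex.choose, rfl, by simp only; rw [← sub_eq_iff_eq_add]; exact h1⟩

end Inner

/-! ### The operators `H_{a q}` -/

theorem inner_eq_of_jump_eq_zero {c d : C2} (hc : jump c = 0) :
    inner ℂ c d = 2 * (conj (meanVal c) * meanVal d) := by
  have h : c 1 = c 0 := (sub_eq_zero.1 hc).symm
  simp only [PiLp.inner_apply, Fin.sum_univ_two, meanVal, h, RCLike.inner_apply, map_div₀, map_add,
    map_ofNat]
  ring

theorem norm_two_mul_meanVal_le (c : C2) : ‖2 * meanVal c‖ ≤ 2 * ‖c‖ := by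
  have h0 := PiLp.norm_apply_le c 0
  have h1 := PiLp.norm_apply_le c 1
  calc ‖2 * meanVal c‖ = ‖c 0 + c 1‖ := by rw [meanVal]; ring_nf
    _ ≤ ‖c 0‖ + ‖c 1‖ := norm_add_le _ _
    _ ≤ 2 * ‖c‖ := by linarith

theorem meanVal_add (c d : C2) : meanVal (c + d) = meanVal c + meanVal d := by
  simp only [meanVal, PiLp.add_apply]
  ring

theorem meanVal_smul (r : ℂ) (c : C2) : meanVal (r • c) = r * meanVal c := by
  simp only [meanVal, PiLp.smul_apply, smul_eq_mul]
  ring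

/-- The vector `(1, 1)`. -/
def oneC2 : C2 := WithLp.toLp 2 ![1, 1]

theorem meanVal_oneC2 : meanVal oneC2 = 1 := by simp [meanVal, oneC2]

theorem jump_smul_oneC2 (r : ℂ) : jump (r • oneC2) = 0 := by simp [jump, oneC2]

theorem norm_oneC2_sq : ‖oneC2‖ ^ 2 = 2 := by
  rw [EuclideanSpace.norm_sq_eq]
  simp [oneC2, Fin.sum_univ_two]
  norm_num

/-- As both boundary vectors have zero jump, the boundary terms of Green's formula involve only
means. The boundary conditions then cancel the terms in `a` and leave pairings with `q`, which
cancel those from the summand `[f]_r q` of the operators. -/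
theorem graphH_formalAdjoint {a : ℂ} {q : L2 C2} {p r : L2 C2 × L2 C2} (hp : p ∈ graphH a q)
    (hr : r ∈ graphH (conj a) q) : inner ℂ p.2 r.1 = inner ℂ p.1 r.2 := by
  obtain ⟨f', f'', c₀, c₁, hf, hc, hc₁, ef⟩ := hp
  obtain ⟨g', g'', d₀, d₁, hg, hd, hd₁, eg⟩ := hr
  have h := hf.green hg
  have h1 := inner_eq_of_jump_eq_zero (d := d₁) hc
  have h2 : inner ℂ c₁ d₀ = 2 * (conj (meanVal c₁) * meanVal d₀) := by
    rw [← inner_conj_symm, inner_eq_of_jump_eq_zero hd]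
    simp [mul_comm, Complex.conj_ofNat]
  have h3 : 2 * conj (meanVal c₁) = conj a * conj (meanVal c₀) + inner ℂ p.1 q := by
    have := congrArg conj hc₁
    simpa [pairing, inner_conj_symm, Complex.conj_ofNat] using this
  rw [pairing] at hd₁
  rw [ef, eg, inner_add_left, inner_add_right, inner_neg_left, inner_neg_right, inner_smul_left,
    inner_smul_right]
  rw [h1, h2] at h
  linear_combination -h - conj (meanVal c₀) * hd₁ + meanVal d₀ * h3

/-! ### Solvability at a real point `-κ²`. -/

section RealPoint

variable {κ : ℝ} {E : Type} [NormedAddCommGroup E] [InnerProductSpace ℂ E] [CompleteSpace E]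

theorem energy_forward {u w : L2 E} {c : E} (hu : IsW1 u (w - (κ : ℂ) • u) c) :
    2 * κ * ‖u‖ ^ 2 = ‖c‖ ^ 2 + 2 * (inner ℂ w u).re := by
  have h := congrArg Complex.re (hu.inner_add_inner hu)
  have h2 : (inner ℂ u w).re = (inner ℂ w u).re := by
    rw [← inner_conj_symm, Complex.conj_re]
  rw [inner_sub_left, inner_sub_right, inner_smul_left, inner_smul_right,
    inner_self_eq_norm_sq_to_K, inner_self_eq_norm_sq_to_K] at h
  simp [← Complex.ofReal_pow, h2] at h
  linarith

theorem energy_backward {w g : L2 E} {c : E} (hw : IsW1 w ((κ : ℂ) • w - g) c) :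
    2 * κ * ‖w‖ ^ 2 + ‖c‖ ^ 2 = 2 * (inner ℂ g w).re := by
  have h := congrArg Complex.re (hw.inner_add_inner hw)
  have h2 : (inner ℂ w g).re = (inner ℂ g w).re := by
    rw [← inner_conj_symm, Complex.conj_re]
  rw [inner_sub_left, inner_sub_right, inner_smul_left, inner_smul_right,
    inner_self_eq_norm_sq_to_K, inner_self_eq_norm_sq_to_K] at h
  simp [← Complex.ofReal_pow, h2] at h
  linarith

theorem re_inner_le {V : Type*} [NormedAddCommGroup V] [InnerProductSpace ℂ V] (g w : V) :
    (inner ℂ g w).re ≤ ‖g‖ * ‖w‖ :=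
  (Complex.re_le_norm _).trans (norm_inner_le_norm _ _)

theorem norm_forward_le {u w : L2 E} (hκ : 1 ≤ κ) (hu : IsW1 u (w - (κ : ℂ) • u) 0) :
    ‖u‖ ≤ ‖w‖ := by
  have h := energy_forward hu
  have h2 := re_inner_le w u
  by_contra! hlt
  rw [norm_zero] at h
  nlinarith [norm_nonneg w, norm_nonneg u, sq_nonneg ‖u‖]

theorem norm_backward_le {w g : L2 E} {c : E} (hκ : 1 ≤ κ)
    (hw : IsW1 w ((κ : ℂ) • w - g) c) : ‖w‖ ≤ ‖g‖ ∧ ‖c‖ ≤ ‖g‖ := by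
  have h := energy_backward hw
  have h2 := re_inner_le g w
  constructor
  · by_contra! hlt
    nlinarith [norm_nonneg w, norm_nonneg g, sq_nonneg ‖c‖, sq_nonneg ‖w‖]
  · apply le_of_sq_le_sq _ (norm_nonneg g)
    nlinarith [sq_nonneg (‖g‖ - ‖w‖), sq_nonneg ‖w‖, sq_nonneg ‖g‖]

/-- The function `e^{-κx} (1, 1)` and its norm. -/
theorem exists_exponential (hκ : 1 ≤ κ) :
    ∃ e : L2 C2, IsW1 e (-((κ : ℂ) • e)) oneC2 ∧ ‖e‖ ≤ 1 := by
  obtain ⟨e, he⟩ := exists_isW1_forward (k := (κ : ℂ)) (by simpa using by linarith) (0 : L2 C2) oneC2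
  have h := energy_forward he
  rw [norm_oneC2_sq, inner_zero_left, Complex.zero_re] at h
  refine ⟨e, by simpa using he, ?_⟩
  nlinarith [norm_nonneg e]

theorem isW2_exponential {e : L2 C2} {c : C2} {k : ℂ} (he : IsW1 e (-(k • e)) c) :
    IsW2 e (-(k • e)) (k ^ 2 • e) c (-(k • c)) := by
  refine ⟨he, ?_⟩
  convert he.smul (-k) using 1 <;> simp [smul_smul, sq]

end RealPoint

theorem IsW2.add {E : Type} [NormedAddCommGroup E] [NormedSpace ℂ E]
    {f f' f'' g g' g'' : L2 E} {c₀ c₁ d₀ d₁ : E} (hf : IsW2 f f' f'' c₀ c₁)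
    (hg : IsW2 g g' g'' d₀ d₁) : IsW2 (f + g) (f' + g') (f'' + g'') (c₀ + d₀) (c₁ + d₁) :=
  ⟨hf.1.add hg.1, hf.2.add hg.2⟩

theorem IsW2.smul {E : Type} [NormedAddCommGroup E] [NormedSpace ℂ E]
    {f f' f'' : L2 E} {c₀ c₁ : E} (r : ℂ) (hf : IsW2 f f' f'' c₀ c₁) :
    IsW2 (r • f) (r • f') (r • f'') (r • c₀) (r • c₁) :=
  ⟨hf.1.smul r, hf.2.smul r⟩

/-- A point `-κ²` of the resolvent set, the same for `a` and `conj a`. -/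
def resolventPoint (a : ℂ) (q : L2 C2) : ℝ := 1 + ‖a‖ + 3 * ‖q‖ + ‖q‖ ^ 2

theorem exists_mem_graphH (a : ℂ) (q g : L2 C2) :
    ∃ f : L2 C2, (f, g - (resolventPoint a q : ℂ) ^ 2 • f) ∈ graphH a q := by
  set κ : ℝ := resolventPoint a q with hκdef
  have hκ : 1 ≤ κ := by rw [hκdef, resolventPoint]; linarith [norm_nonneg a, norm_nonneg q, sq_nonneg ‖q‖]
  have hre : 0 < (κ : ℂ).re := by simpa using by linarith
  obtain ⟨wg, cg, hwg⟩ := exists_isW1_backward hre g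
  obtain ⟨ug, hug⟩ := exists_isW1_forward hre wg 0
  obtain ⟨wq, cq, hwq⟩ := exists_isW1_backward hre q
  obtain ⟨uq, huq⟩ := exists_isW1_forward hre wq 0
  obtain ⟨e, he, hen⟩ := exists_exponential hκ
  obtain ⟨bwq, bcq⟩ := norm_backward_le hκ hwq
  have buq := (norm_forward_le hκ huq).trans bwq
  -- Ansatz `f = ug - c uq + c e`: then `f(0+) = c (1, 1)`, and `-c uq` accounts for the term `[f]_r
  -- q`. The condition on `[f']_r` becomes the scalar equation `c D = 2 [cg]_r - (ug, q)₊`.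
  set D : ℂ := 2 * meanVal cq + 2 * κ + a - inner ℂ q uq + inner ℂ q e with hD
  -- If `D = 0`, then `2κ` is at most `‖q‖² + ‖q‖ + 2‖q‖ + ‖a‖ = κ - 1`; this dictates the constant
  -- in `resolventPoint`.
  have hD0 : D ≠ 0 := by
    intro h0
    have h1 : (2 * κ : ℂ) = inner ℂ q uq - inner ℂ q e - 2 * meanVal cq - a := by
      linear_combination -hD + h0
    have h2 : ‖(2 * κ : ℂ)‖ = 2 * κ := by
      rw [norm_mul, Complex.norm_real, Real.norm_of_nonneg (by linarith)]; simp
    have h3 : ‖inner ℂ q uq‖ ≤ ‖q‖ * ‖q‖ := (norm_inner_le_norm _ _).trans (by gcongr)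
    have h4 : ‖inner ℂ q e‖ ≤ ‖q‖ * 1 := (norm_inner_le_norm _ _).trans (by gcongr)
    have h5 : ‖2 * meanVal cq‖ ≤ 2 * ‖q‖ := (norm_two_mul_meanVal_le cq).trans (by gcongr)
    have h6 := norm_sub_le (inner ℂ q uq - inner ℂ q e - 2 * meanVal cq) a
    have h7 := norm_sub_le (inner ℂ q uq - inner ℂ q e) (2 * meanVal cq)
    have h8 := norm_sub_le (inner ℂ q uq) (inner ℂ q e)
    rw [← h1, h2] at h6
    rw [hκdef, resolventPoint] at h6
    nlinarith [norm_nonneg a, norm_nonneg q]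
  set c : ℂ := (2 * meanVal cg - inner ℂ q ug) / D with hc
  have hcD : c * D = 2 * meanVal cg - inner ℂ q ug := div_mul_cancel₀ _ hD0
  have hf := ((isW2_of_first_order hwg hug).add ((isW2_of_first_order hwq huq).smul (-c))).add
    ((isW2_exponential he).smul c)
  refine ⟨_, _, _, _, _, hf, ?_, ?_, ?_⟩
  · simp only [smul_zero, zero_add, jump_smul_oneC2]
  · have hm : meanVal (-((κ : ℂ) • oneC2)) = -κ := by
      rw [← neg_smul, meanVal_smul, meanVal_oneC2, mul_one]
    simp only [pairing, smul_zero, zero_add, sub_zero, meanVal_add, meanVal_smul, inner_add_right,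
      inner_smul_right, meanVal_oneC2, hm]
    linear_combination -hcD + c * hD
  · simp only [smul_zero, zero_add, meanVal_smul, meanVal_oneC2]
    module

theorem exists_mem_graphH_conj (a : ℂ) (q g : L2 C2) :
    ∃ f : L2 C2, (f, g - (resolventPoint a q : ℂ) ^ 2 • f) ∈ graphH (conj a) q := by
  have : resolventPoint a q = resolventPoint (conj a) q := by
    rw [resolventPoint, resolventPoint, RCLike.norm_conj]
  rw [this]
  exact exists_mem_graphH (conj a) q g

/-! ### Density of the domain, the adjoint, and uniqueness of the parameters. -/

theorem eq_zero_of_forall_graphH {a : ℂ} {q v : L2 C2}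
    (h : ∀ p ∈ graphH a q, inner ℂ (p.2 + (resolventPoint a q : ℂ) ^ 2 • p.1) v = 0) : v = 0 := by
  obtain ⟨f, hf⟩ := exists_mem_graphH a q v
  have := h _ hf
  simpa using this

/-- For `g` orthogonal to the domain, solve `(H_{conj a, q} + κ²) v = g`. Formal adjointness makes
`v` orthogonal to the range of `H_{a q} + κ²`, which is everything; so `v = 0` and `g = 0`. -/
theorem dense_domain_opH (a : ℂ) (q : L2 C2) : Dense ((opH a q).domain : Set (L2 C2)) := by
  rw [Submodule.dense_iff_topologicalClosure_eq_top, Submodule.topologicalClosure_eq_top_iff,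
    Submodule.eq_bot_iff]
  intro g hg
  obtain ⟨v, hv⟩ := exists_mem_graphH_conj a q g
  have hv0 : v = 0 := by
    refine eq_zero_of_forall_graphH (a := a) (q := q) fun p hp => ?_
    have h1 := graphH_formalAdjoint hp hv
    have h2 : inner ℂ p.1 g = 0 :=
      (Submodule.mem_orthogonal _ _).1 hg _ (Submodule.mem_map_of_mem (f := LinearMap.fst _ _ _) hp)
    rw [inner_sub_right, inner_smul_right, h2] at h1
    simp only at h1
    rw [inner_add_left, inner_smul_left, h1]
    simp
  have := graphH_functional _ _ _ hv hv0
  simpa [hv0] using this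

/-- For `(y, w)` in the adjoint graph, solve `(H_{conj a, q} + κ²) f = w + κ² y`. Then `y - f` is
orthogonal to the full range of `H_{a q} + κ²`, hence `y = f`. -/
theorem opH_adjoint (a : ℂ) (q : L2 C2) : (opH a q).adjoint = opH (conj a) q := by
  apply LinearPMap.eq_of_eq_graph
  rw [LinearPMap.adjoint_graph_eq_graph_adjoint (dense_domain_opH a q), opH_graph, opH_graph]
  ext ⟨y, w⟩
  rw [Submodule.mem_adjoint_iff]
  constructor
  · intro h
    obtain ⟨f, hf⟩ := exists_mem_graphH_conj a q (w + (resolventPoint a q : ℂ) ^ 2 • y)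
    have hyf : y - f = 0 := by
      refine eq_zero_of_forall_graphH (a := a) (q := q) fun p hp => ?_
      have h1 := graphH_formalAdjoint hp hf
      have h2 := h p.1 p.2 hp
      simp only [inner_sub_right, inner_add_right, inner_smul_right, inner_add_left,
        inner_smul_left, map_pow, Complex.conj_ofReal] at h1 h2 ⊢
      linear_combination h2 - h1
    obtain rfl := sub_eq_zero.1 hyf
    simpa using hf
  · intro h a' b' hp
    exact sub_eq_zero.2 (graphH_formalAdjoint hp h)

/-- The operator `H_{a q}` determines `a` and `q`. -/
theorem opH_injective {a b : ℂ} {q p : L2 C2} (h : opH a q = opH b p) : a = b ∧ q = p := by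
  have hg : graphH a q = graphH b p := by rw [← opH_graph, ← opH_graph, h]
  -- A function of the domain with `[f]_r = 1` is sought as `(1 - β) e^{-x} (1, 1) + β e^{-κx} (1,
  -- 1)`; its boundary condition is linear in `β`. With `κ = 2 + ‖q‖` the coefficient `A' - A` is
  -- nonzero, since `2(κ - 1) > 2‖q‖`.
  have hκ : (1 : ℝ) ≤ 2 + ‖q‖ := by linarith [norm_nonneg q]
  obtain ⟨e, he, hen⟩ := exists_exponential le_rfl
  obtain ⟨e', he', hen'⟩ := exists_exponential hκ
  set A : ℂ := -(2 * (1 : ℝ)) - inner ℂ q e with hA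
  set A' : ℂ := -(2 * (2 + ‖q‖ : ℝ)) - inner ℂ q e' with hA'
  have hAA : A' - A ≠ 0 := by
    intro h0
    have h1 : ((2 * (1 + ‖q‖) : ℝ) : ℂ) = inner ℂ q e - inner ℂ q e' := by
      push_cast at hA hA' ⊢
      linear_combination -h0 + hA' - hA
    have h2 := congrArg norm h1
    rw [Complex.norm_real, Real.norm_of_nonneg (by positivity)] at h2
    have h3 : ‖inner ℂ q e‖ ≤ ‖q‖ * 1 := (norm_inner_le_norm _ _).trans (by gcongr)
    have h4 : ‖inner ℂ q e'‖ ≤ ‖q‖ * 1 := (norm_inner_le_norm _ _).trans (by gcongr)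
    have h5 := norm_sub_le (inner ℂ q e) (inner ℂ q e')
    linarith
  set β : ℂ := (a - A) / (A' - A) with hβ
  have hβA : β * (A' - A) = a - A := div_mul_cancel₀ _ hAA
  have hf := ((isW2_exponential he).smul (1 - β)).add ((isW2_exponential he').smul β)
  have hm : ∀ k : ℂ, meanVal (-(k • oneC2)) = -k := fun k => by
    rw [← neg_smul, meanVal_smul, meanVal_oneC2, mul_one]
  have hj : jump ((1 - β) • oneC2 + β • oneC2) = 0 := by
    rw [← add_smul, jump_smul_oneC2]
  have hm0 : meanVal ((1 - β) • oneC2 + β • oneC2) = 1 := by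
    simp only [meanVal_add, meanVal_smul, meanVal_oneC2]
    ring
  have hmem := show (_, _) ∈ graphH a q from ⟨_, _, _, _, hf, hj, by
    rw [hm0]
    simp only [pairing, meanVal_add, meanVal_smul, inner_add_right, inner_smul_right, hm]
    linear_combination hβA - (1 - β) * hA - β * hA', rfl⟩
  rw [hg] at hmem
  -- Derivatives and boundary values are determined by `f`. As `[f]_r = 1`, equality of the values
  -- of the operators gives `q = p`, and then the boundary conditions give `a = b`.
  obtain ⟨f', f'', c₀, c₁, hw, -, hb, hq⟩ := hmem
  obtain ⟨rfl, rfl⟩ := hf.1.unique hw.1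
  obtain ⟨rfl, rfl⟩ := hf.2.unique hw.2
  simp only [hm0, one_smul] at hq hb
  have hqp : q = p := add_left_cancel hq
  subst hqp
  refine ⟨?_, rfl⟩
  have : 2 * meanVal ((1 - β) • -(((1 : ℝ) : ℂ) • oneC2) + β • -(((2 + ‖q‖ : ℝ) : ℂ) • oneC2))
      = a * 1 + pairing ((1 - β) • e + β • e') q := by
    simp only [pairing, meanVal_add, meanVal_smul, inner_add_right, inner_smul_right, hm]
    linear_combination hβA - (1 - β) * hA - β * hA'
  linear_combination hb - this

theorem sMatrix_opH (ψ Ψ : Fin 2 → ℂ → ℂ) (a : ℂ) (q : L2 C2) (z : ℂ) :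
    sMatrix ψ Ψ (opH a q) z = sFormula ψ Ψ a q z := by
  have h : ∃ p : ℂ × L2 C2, opH a q = opH p.1 p.2 := ⟨(a, q), rfl⟩
  obtain ⟨h1, h2⟩ := opH_injective h.choose_spec
  rw [sMatrix, dif_pos h, ← h1, ← h2]

/-! ### Symmetry of the Weyl-Titchmarsh function -/

theorem weyl_neg_conj (q : L2 C2) {z : ℂ} (hz : z.im < 0) :
    weyl q (-conj z) = conj (weyl q z) := by
  have h1 := resolventApply_opDirichlet hz q
  have h2 := resolventApply_opDirichlet (z := -conj z) (by simpa using hz) q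
  have h3 := inner_graphDirichlet h1 h2
  have h4 : pairing (resolventApply (opDirichlet C2) ((-conj z) ^ 2) q) q
      = conj (pairing (resolventApply (opDirichlet C2) (z ^ 2) q) q) := by
    simp only [inner_add_left, inner_add_right, inner_smul_left, inner_smul_right, map_pow,
      neg_sq] at h3
    rw [pairing, pairing, inner_conj_symm, neg_sq]
    linear_combination h3
  have h5 : ∫ x in Ioi (0 : ℝ), Complex.exp (-(Complex.I * (-conj z) * x)) *
        (((q x 0).re : ℂ) + ((q x 1).re : ℂ)) =
      conj (∫ x in Ioi (0 : ℝ), Complex.exp (-(Complex.I * z * x)) *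
        (((q x 0).re : ℂ) + ((q x 1).re : ℂ))) := by
    rw [← integral_conj]
    congr 1
    ext x
    simp [← Complex.exp_conj]
  rw [weyl, weyl, h4, h5]
  simp [Complex.conj_ofNat]

/-! ### Boundary uniqueness in a half-plane -/

section BoundaryUniqueness

variable {G : ℂ → ℂ} {C : ℝ}

theorem continuous_vertical (hd : DifferentiableOn ℂ G {z | 0 < z.re}) {z : ℂ} (hz : 0 < z.re) :
    Continuous fun t : ℝ => G (z + t * Complex.I) := by
  rw [continuous_iff_continuousAt]
  intro t
  have h : 0 < (z + t * Complex.I).re := by simpa using hz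
  have h1 : ContinuousAt G (z + t * Complex.I) :=
    (hd.differentiableAt ((isOpen_lt continuous_const Complex.continuous_re).mem_nhds h)).continuousAt
  exact ContinuousAt.comp (f := fun t : ℝ => z + t * Complex.I) h1
    (Continuous.continuousAt (by fun_prop))

/-- Differentiation under the integral. Discs of radius `r = Re z / 2` about points of the ball
around `z` stay in the half-plane, so Cauchy's estimate bounds the derivative by `C / r`. -/
theorem differentiableAt_vertical_integral (hd : DifferentiableOn ℂ G {z | 0 < z.re})
    (hb : ∀ z : ℂ, 0 < z.re → ‖G z‖ ≤ C) (h : ℝ) {z : ℂ} (hz : 0 < z.re) :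
    DifferentiableAt ℂ (fun z => ∫ t in (0 : ℝ)..h, G (z + t * Complex.I)) z := by
  have hopen : IsOpen {z : ℂ | 0 < z.re} := isOpen_lt continuous_const Complex.continuous_re
  set r : ℝ := z.re / 2 with hr
  have hr0 : 0 < r := half_pos hz
  have hre : ∀ w ∈ Metric.ball z r, r < w.re := by
    intro w hw
    have h1 := (Complex.abs_re_le_norm (w - z)).trans_lt (by simpa [dist_eq_norm] using hw)
    rw [Complex.sub_re] at h1
    linarith [(abs_lt.1 h1).1]
  have hderiv : ∀ w : ℂ, r < w.re → ‖deriv G w‖ ≤ C / r := by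
    intro w hw
    refine Complex.norm_deriv_le_of_forall_mem_sphere_norm_le hr0 ?_ ?_
    · refine (hd.mono ?_).diffContOnCl
      refine Metric.closure_ball_subset_closedBall.trans fun v hv => ?_
      have h1 := (Complex.abs_re_le_norm (v - w)).trans (by simpa [dist_eq_norm] using hv)
      rw [Complex.sub_re] at h1
      simp only [mem_ofPred_eq]
      linarith [(abs_le.1 h1).1]
    · intro v hv
      have h1 := (Complex.abs_re_le_norm (v - w)).trans
        (by simpa [dist_eq_norm] using Metric.sphere_subset_closedBall hv)
      rw [Complex.sub_re] at h1
      exact hb v (by linarith [(abs_le.1 h1).1])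
  have hd' : DifferentiableOn ℂ (deriv G) {z | 0 < z.re} := hd.deriv hopen
  refine (intervalIntegral.hasDerivAt_integral_of_dominated_loc_of_deriv_le
    (F := fun z (t : ℝ) => G (z + t * Complex.I))
    (F' := fun z (t : ℝ) => deriv G (z + t * Complex.I))
    (bound := fun _ => C / r) (Metric.ball_mem_nhds z hr0) ?_ ?_ ?_ ?_ ?_ ?_).2.differentiableAt
  · filter_upwards [Metric.ball_mem_nhds z hr0] with w hw
    exact (continuous_vertical hd (hr0.trans (hre w hw))).aestronglyMeasurable
  · exact (continuous_vertical hd hz).intervalIntegrable _ _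
  · exact (continuous_vertical hd' hz).aestronglyMeasurable
  · exact Eventually.of_forall fun t _ w hw => hderiv _ (by simpa using hre w hw)
  · exact intervalIntegrable_const
  · refine Eventually.of_forall fun t _ w hw => ?_
    have h1 : 0 < (w + t * Complex.I).re := by simpa using hr0.trans (hre w hw)
    exact (hd.differentiableAt (hopen.mem_nhds h1)).hasDerivAt.comp_add_const w _

/-- A bounded holomorphic function in the right half-plane whose horizontal boundary limits vanish
almost everywhere is zero. -/
theorem eq_zero_of_ae_boundary_zero (hd : DifferentiableOn ℂ G {z | 0 < z.re})
    (hb : ∀ z : ℂ, 0 < z.re → ‖G z‖ ≤ C)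
    (h0 : ∀ᵐ δ : ℝ, Tendsto (fun y : ℝ => G (y + δ * Complex.I)) (𝓝[>] (0 : ℝ)) (𝓝 0))
    {z : ℂ} (hz : 0 < z.re) : G z = 0 := by
  have hC : 0 ≤ C := (norm_nonneg _).trans (hb z hz)
  -- `G` need not extend continuously to the boundary, but its integrals over vertical segments of
  -- fixed length do, with boundary value zero.
  have key : ∀ h : ℝ, ∫ t in (0 : ℝ)..h, G (z + t * Complex.I) = 0 := by
    intro h
    set P : ℂ → ℂ := fun z => if 0 < z.re then ∫ t in (0 : ℝ)..h, G (z + t * Complex.I) else 0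
      with hP
    have hPb : ∀ z, ‖P z‖ ≤ C * |h| := by
      intro z
      by_cases hz : 0 < z.re
      · simp only [hP, if_pos hz]
        have := intervalIntegral.norm_integral_le_of_norm_le_const (a := 0) (b := h)
          (f := fun t : ℝ => G (z + t * Complex.I)) (C := C) fun t _ => hb _ (by simpa using hz)
        simpa using this
      · simp only [hP, if_neg hz, norm_zero]
        positivity
    have hopen : IsOpen {z : ℂ | 0 < z.re} := isOpen_lt continuous_const Complex.continuous_re
    have hPd : ∀ z : ℂ, 0 < z.re → DifferentiableAt ℂ P z := by
      intro z hz
      refine (differentiableAt_vertical_integral hd hb h hz).congr_of_eventuallyEq ?_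
      filter_upwards [hopen.mem_nhds hz] with w hw
      exact if_pos hw
    have hPc : ∀ z₀ : ℂ, z₀.re = 0 → Tendsto P (𝓝 z₀) (𝓝 0) := by
      intro z₀ hz₀
      set φ : ℝ → ℝ := fun x => if 0 < x then
        ‖∫ t in z₀.im..(z₀.im + h), G (x + t * Complex.I)‖ else 0 with hφ
      have hφ0 : Tendsto φ (𝓝 0) (𝓝 0) := by
        suffices Tendsto φ (𝓝[≤] 0 ⊔ 𝓝[>] 0) (𝓝 0) by rwa [nhdsLE_sup_nhdsGT] at this
        refine tendsto_sup.2 ⟨?_, ?_⟩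
        · refine tendsto_const_nhds.congr' ?_
          filter_upwards [self_mem_nhdsWithin] with x hx
          exact (if_neg (not_lt.2 hx)).symm
        -- Dominated convergence turns the almost-everywhere horizontal limits into convergence of
        -- the segment integrals.
        · have h1 : Tendsto (fun x : ℝ => ∫ t in z₀.im..(z₀.im + h), G (x + t * Complex.I))
              (𝓝[>] 0) (𝓝 (∫ t in z₀.im..(z₀.im + h), (0 : ℂ))) := by
            refine intervalIntegral.tendsto_integral_filter_of_dominated_convergence (fun _ => C)
              ?_ ?_ intervalIntegrable_const ?_
            · filter_upwards [self_mem_nhdsWithin] with x hx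
              exact (continuous_vertical hd (z := (x : ℂ)) (by simpa using hx)).aestronglyMeasurable
            · filter_upwards [self_mem_nhdsWithin] with x hx
              exact Eventually.of_forall fun t _ => hb _ (by simpa using hx)
            · filter_upwards [h0] with t ht _ using ht
          have h2 := h1.norm
          simp only [intervalIntegral.integral_zero, norm_zero] at h2
          refine h2.congr' ?_
          filter_upwards [self_mem_nhdsWithin] with x hx
          exact (if_pos hx).symm
      -- Sliding the segment from height `w.im` to `z₀.im` costs at most `C |w.im - z₀.im|` at each
      -- end; this upgrades horizontal to full convergence at `z₀`.
      have hle : ∀ w, ‖P w‖ ≤ φ w.re + 2 * (C * |w.im - z₀.im|) := by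
        intro w
        by_cases hw : 0 < w.re
        · simp only [hP, hφ, if_pos hw]
          set g : ℝ → ℂ := fun t => G (w.re + t * Complex.I) with hg
          have hgc : Continuous g := continuous_vertical hd (z := (w.re : ℂ)) (by simpa using hw)
          have hgb : ∀ t, ‖g t‖ ≤ C := fun t => hb _ (by simpa using hw)
          have e1 : ∫ t in (0 : ℝ)..h, G (w + t * Complex.I) = ∫ t in w.im..(w.im + h), g t := by
            have := intervalIntegral.integral_comp_add_left (a := 0) (b := h) g w.im
            rw [add_zero] at this
            rw [← this]
            congr 1
            ext t
            simp only [hg]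
            congr 1
            apply Complex.ext <;> simp
          have i : ∀ a b, IntervalIntegrable g volume a b := fun a b => hgc.intervalIntegrable a b
          have e2 : ∫ t in w.im..(w.im + h), g t = (∫ t in z₀.im..(z₀.im + h), g t)
              + ((∫ t in (z₀.im + h)..(w.im + h), g t) - ∫ t in z₀.im..w.im, g t) := by
            have a1 := intervalIntegral.integral_add_adjacent_intervals
              (i z₀.im (z₀.im + h)) (i (z₀.im + h) (w.im + h))
            have a2 := intervalIntegral.integral_add_adjacent_intervals
              (i z₀.im w.im) (i w.im (w.im + h))
            linear_combination a2 - a1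
          have b1 : ‖∫ t in (z₀.im + h)..(w.im + h), g t‖ ≤ C * |w.im - z₀.im| := by
            have := intervalIntegral.norm_integral_le_of_norm_le_const
              (a := z₀.im + h) (b := w.im + h) (f := g) fun t _ => hgb t
            simpa using this
          have b2 : ‖∫ t in z₀.im..w.im, g t‖ ≤ C * |w.im - z₀.im| :=
            intervalIntegral.norm_integral_le_of_norm_le_const fun t _ => hgb t
          rw [e1, e2]
          refine (norm_add_le _ _).trans ?_
          have := norm_sub_le (∫ t in (z₀.im + h)..(w.im + h), g t) (∫ t in z₀.im..w.im, g t)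
          linarith
        · simp only [hP, hφ, if_neg hw, norm_zero]
          positivity
      apply squeeze_zero_norm hle
      have l1 : Tendsto (fun w : ℂ => φ w.re) (𝓝 z₀) (𝓝 0) :=
        hφ0.comp (hz₀ ▸ Complex.continuous_re.tendsto z₀)
      have l2 : Tendsto (fun w : ℂ => 2 * (C * |w.im - z₀.im|)) (𝓝 z₀) (𝓝 0) :=
        Continuous.tendsto' (by fun_prop) _ _ (by simp)
      simpa using l1.add l2
    have hPz : ‖P z‖ ≤ 0 := by
      refine PhragmenLindelof.right_half_plane_of_bounded_on_real ?_ ?_ ?_ ?_ hz.le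
      · refine ⟨fun w hw => (hPd w hw).differentiableWithinAt, fun w hw => ?_⟩
        rw [Complex.closure_setOfPred_lt_re] at hw
        rcases (show (0 : ℝ) ≤ w.re from hw).eq_or_lt with h1 | h1
        · have : P w = 0 := if_neg (by rw [← h1]; exact lt_irrefl _)
          refine ContinuousAt.continuousWithinAt ?_
          rw [ContinuousAt, this]
          exact hPc w h1.symm
        · exact (hPd w h1).continuousAt.continuousWithinAt
      · refine ⟨1, by norm_num, 0, Asymptotics.IsBigO.of_bound (C * |h|) ?_⟩
        exact Eventually.of_forall fun w => by simpa using hPb w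
      · exact isBoundedUnder_of ⟨_, fun x => hPb x⟩
      · intro x
        simp [hP]
    have := norm_le_zero_iff.1 hPz
    simpa only [hP, if_pos hz] using this
  -- The segment integrals vanish for every length `h`; their derivative at `h = 0` is `G z`.
  have h1 := (continuous_vertical hd hz).deriv_integral (fun t : ℝ => G (z + t * Complex.I)) 0 0
  simp only [key, deriv_const] at h1
  simpa using h1.symm

end BoundaryUniqueness

/-! ### Symmetry of the `S`-matrix -/

/-- Conjugation is inversion on the unit circle; for `ψ = 0` both sides are `0 / 0 = 0`. -/
theorem bdry_symm {ψ : ℂ → ℂ} (h : IsInnerFunction ψ ∨ ψ = 0) :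
    ∀ᵐ δ : ℝ, conj (bdry ψ δ / bdry ψ (-δ)) = bdry ψ (-δ) / bdry ψ δ := by
  rcases h with h | rfl
  · have h1 : ∀ᵐ δ : ℝ, ‖bdry ψ δ‖ = 1 := by
      filter_upwards [h.boundary] with δ ⟨w, hw, hlim⟩
      rw [bdry, hlim.limUnder_eq, hw]
    have h2 : ∀ᵐ δ : ℝ, ‖bdry ψ (-δ)‖ = 1 :=
      (Measure.measurePreserving_neg (volume : Measure ℝ)).quasiMeasurePreserving.ae h1
    filter_upwards [h1, h2] with δ d1 d2
    rw [map_div₀, ← Complex.inv_eq_conj d1, ← Complex.inv_eq_conj d2]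
    simp [div_eq_mul_inv, mul_comm]
  · have h1 : ∀ δ : ℝ, bdry 0 δ = 0 := fun δ => tendsto_const_nhds.limUnder_eq
    simp [h1]

theorem IsContinuation.neg_conj {ψ Ψ : ℂ → ℂ} (hψ : IsInnerFunction ψ ∨ ψ = 0)
    (h : IsContinuation ψ Ψ) {z : ℂ} (hz : z.im < 0) : Ψ (-conj z) = conj (Ψ z) := by
  -- The rotation `w ↦ -iw` carries the right half-plane to `ℂ₋`, and reflection in the real axis
  -- corresponds to `z ↦ -conj z`.
  set H : ℂ → ℂ := fun w => Ψ (-Complex.I * w) with hH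
  have hHd : DifferentiableOn ℂ H {w | 0 < w.re} :=
    h.differentiableOn.comp (by fun_prop) fun w hw => by simpa using hw
  have hopen : IsOpen {z : ℂ | 0 < z.re} := isOpen_lt continuous_const Complex.continuous_re
  set G : ℂ → ℂ := fun w => conj (H (conj w)) - H w with hG
  have hGd : DifferentiableOn ℂ G {w | 0 < w.re} := by
    refine DifferentiableOn.sub (fun w hw => DifferentiableAt.differentiableWithinAt ?_) hHd
    have h1 : DifferentiableAt ℂ H (conj w) :=
      hHd.differentiableAt (hopen.mem_nhds (by simpa using hw))
    have h2 := differentiableAt_conj_conj_iff.2 h1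
    simpa [Function.comp_def] using h2
  have hHb : ∀ w : ℂ, 0 < w.re → ‖H w‖ ≤ 1 := fun w hw => h.norm_le_one _ (by simpa using hw)
  have hGb : ∀ w : ℂ, 0 < w.re → ‖G w‖ ≤ 2 := by
    intro w hw
    refine (norm_sub_le _ _).trans ?_
    rw [RCLike.norm_conj]
    linarith [hHb w hw, hHb (conj w) (by simpa using hw)]
  have hG0 : ∀ᵐ δ : ℝ, Tendsto (fun y : ℝ => G (y + δ * Complex.I)) (𝓝[>] (0 : ℝ)) (𝓝 0) := by
    have hneg := (Measure.measurePreserving_neg (volume : Measure ℝ)).quasiMeasurePreserving.ae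
      h.boundary
    filter_upwards [h.boundary, hneg, bdry_symm hψ] with δ h1 h2 h3
    have h4 := (Complex.continuous_conj.tendsto _).comp h2
    rw [neg_neg, h3] at h4
    have h5 := h4.sub h1
    rw [sub_self] at h5
    refine h5.congr fun y => ?_
    simp only [hG, hH, Function.comp_apply]
    congr 3
    · apply Complex.ext <;> simp
    · apply Complex.ext <;> simp
  have := eq_zero_of_ae_boundary_zero hGd hGb hG0 (z := Complex.I * z) (by simpa using hz)
  simp only [hG, hH] at this
  have e1 : -Complex.I * (Complex.I * z) = z := by linear_combination -z * Complex.I_sq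
  have e2 : -Complex.I * conj (Complex.I * z) = -conj z := by
    rw [map_mul, Complex.conj_I]
    linear_combination conj z * Complex.I_sq
  rw [e1, e2, sub_eq_zero] at this
  rw [← this, Complex.conj_conj]

/-- No condition `a ≠ W` is needed: the two denominators are conjugate, so they vanish together, and
both quotients are then `0` by convention. Hence the identity holds throughout `ℂ₋` and passes to
limits. -/
theorem sFormula_conjTranspose {ψ Ψ : Fin 2 → ℂ → ℂ} (a : ℂ) (q : L2 C2)
    (hψ : ∀ j, IsInnerFunction (ψ j) ∨ ψ j = 0) (hΨ : ∀ j, IsContinuation (ψ j) (Ψ j))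
    {z : ℂ} (hz : z.im < 0) :
    (sFormula ψ Ψ a q z).conjTranspose = sFormula ψ Ψ (conj a) q (-conj z) := by
  ext i j
  have hd : conj ((Matrix.diagonal fun j => Ψ j z) j i)
      = (Matrix.diagonal fun j => Ψ j (-conj z)) i j := by
    by_cases hij : i = j
    · subst hij
      simp [(hΨ i).neg_conj (hψ i) hz]
    · simp [Matrix.diagonal_apply_ne _ hij, Matrix.diagonal_apply_ne _ (Ne.symm hij)]
  simp only [sFormula, Matrix.conjTranspose_apply, Matrix.sub_apply, Matrix.smul_apply,
    Matrix.of_apply, smul_eq_mul, RCLike.star_def, map_sub, hd]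
  rw [weyl_neg_conj q hz]
  simp only [map_mul, map_div₀, map_sub, Complex.conj_conj, map_neg, neg_neg, Complex.conj_I,
    Complex.conj_ofNat]
  ring

theorem tendsto_conjTranspose_neg_conj {S T : ℂ → Matrix (Fin 2) (Fin 2) ℂ}
    (h : ∀ z : ℂ, z.im < 0 → (S z).conjTranspose = T (-conj z)) {z : ℂ} (hz : z.im < 0)
    {M : Matrix (Fin 2) (Fin 2) ℂ} (hM : Tendsto S (𝓝[≠] z) (𝓝 M)) :
    Tendsto T (𝓝[≠] (-conj z)) (𝓝 M.conjTranspose) := by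
  have hc : Continuous fun w : ℂ => -conj w := Complex.continuous_conj.neg
  have h1 : Tendsto (fun w : ℂ => -conj w) (𝓝[≠] (-conj z)) (𝓝[≠] z) := by
    refine tendsto_nhdsWithin_iff.2 ⟨(hc.tendsto' _ _ (by simp)).mono_left nhdsWithin_le_nhds, ?_⟩
    filter_upwards [self_mem_nhdsWithin] with w hw hwz
    apply hw
    rw [mem_singleton_iff.1 hwz.symm]
    simp
  have h2 := ((continuous_id.matrix_conjTranspose).tendsto M).comp (hM.comp h1)
  refine h2.congr' ?_
  have hopen : IsOpen {w : ℂ | w.im < 0} := isOpen_lt Complex.continuous_im continuous_const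
  filter_upwards [nhdsWithin_le_nhds (hopen.mem_nhds
    (show -conj z ∈ {w : ℂ | w.im < 0} by simpa using hz))] with w hw
  have := h (-conj w) (by simpa using hw)
  simpa using this

end NonlocalDelta

end

theorem lemma5p4 (a : ℂ) (q : NonlocalDelta.L2 NonlocalDelta.C2) (ψ Ψ : Fin 2 → ℂ → ℂ)
    (hψ : NonlocalDelta.IsAdmissible q ψ)
    (hΨ : ∀ j, NonlocalDelta.IsContinuation (ψ j) (Ψ j)) :
    Dense ((NonlocalDelta.opH a q).domain : Set (NonlocalDelta.L2 NonlocalDelta.C2)) ∧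
    (∃ (b : ℂ) (p : NonlocalDelta.L2 NonlocalDelta.C2),
      (NonlocalDelta.opH a q).adjoint = NonlocalDelta.opH b p) ∧
    ∀ z : ℂ, z.im < 0 →
    (a ≠ NonlocalDelta.weyl q z →
      conj a ≠ NonlocalDelta.weyl q (-conj z) ∧
      (NonlocalDelta.sMatrix ψ Ψ (NonlocalDelta.opH a q) z).conjTranspose
        = NonlocalDelta.sMatrix ψ Ψ (NonlocalDelta.opH (conj a) q) (-conj z) ∧
      NonlocalDelta.sMatrix ψ Ψ (NonlocalDelta.opH (conj a) q) (-conj z)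
        = NonlocalDelta.sMatrix ψ Ψ (NonlocalDelta.opH a q).adjoint (-conj z)) ∧
    (∀ M : Matrix (Fin 2) (Fin 2) ℂ,
      Tendsto (NonlocalDelta.sMatrix ψ Ψ (NonlocalDelta.opH a q)) (𝓝[≠] z) (𝓝 M) →
      Tendsto (NonlocalDelta.sMatrix ψ Ψ (NonlocalDelta.opH (conj a) q)) (𝓝[≠] (-conj z))
        (𝓝 M.conjTranspose) ∧
      Tendsto (NonlocalDelta.sMatrix ψ Ψ (NonlocalDelta.opH a q).adjoint) (𝓝[≠] (-conj z))
        (𝓝 M.conjTranspose)) := by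
  have hS : ∀ b : ℂ, NonlocalDelta.sMatrix ψ Ψ (NonlocalDelta.opH b q)
      = NonlocalDelta.sFormula ψ Ψ b q :=
    fun b => funext fun z => NonlocalDelta.sMatrix_opH ψ Ψ b q z
  have hT : ∀ z : ℂ, z.im < 0 → (NonlocalDelta.sFormula ψ Ψ a q z).conjTranspose
      = NonlocalDelta.sFormula ψ Ψ (conj a) q (-conj z) :=
    fun z hz => NonlocalDelta.sFormula_conjTranspose a q hψ.inner_or_zero hΨ hz
  refine ⟨NonlocalDelta.dense_domain_opH a q, ⟨conj a, q, NonlocalDelta.opH_adjoint a q⟩,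
    fun z hz => ?_⟩
  -- Once the adjoint is identified, the claims about it coincide with those about `H_{conj a, q}`.
  rw [NonlocalDelta.opH_adjoint, hS, hS]
  refine ⟨fun ha => ⟨?_, hT z hz, rfl⟩, fun M hM => ?_⟩
  · rw [NonlocalDelta.weyl_neg_conj q hz]
    exact fun h => ha ((starRingEnd ℂ).injective h)
  · have := NonlocalDelta.tendsto_conjTranspose_neg_conj hT hz hM
    exact ⟨this, this⟩
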